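/- **Setting.** For a precision $\beta\in\mathbb N$ let $\varepsilon=2^{-\beta}$, let $\mathbb F_\beta=\{m2^e: m,e\in\mathbb Z,\ |m|\le 2^\beta\}$, let $\mathrm{rnd}:\mathbb R\to\mathbb F_\beta$ be a rounding to a nearest element (ties broken arbitrarily), and put $x\circledast y=\mathrm{rnd}(\mathrm{rnd}(x)*\mathrm{rnd}(y))$ for $*\in\{+,-,\times,/\}$, and similarly for $\sqrt{\ }$. For $x=w2^{e}>0$ with $\tfrac12\le w<1$ let $m=\lceil\frac{\beta+3}{2}\rceil-e$, $s=x2^m$, and let $$\mathsf{Log}(x)=\frac{\pi}{2\,\mathrm{AGM}(1,4/s)}-m\log 2$$ be the logarithm computed by the arithmetic-geometric mean. Fix $t\in\mathbb N$ and $g\in\mathbb R$ with $g+\frac12>0$. Let $$\mathsf{Fact}(k)=\sqrt{2\pi}\,\bigl(k+g+\tfrac12\bigr)^{k+1/2}e^{-(k+g+1/2)}A_{t,g}(k)$$ be the Lanczos approximation of $k!$, where $A_{t,g}(k)=\tfrac12p_0(g)+\sum_{j=1}^{t-1}p_j(g)\prod_{i=0}^{j-1}\frac{k-i}{k+i+1}$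 is the Lanczos series truncated to $t$ terms (zero for $t=0$), $p_j(g)=\frac{\sqrt2}{\pi}\sum_{l=0}^{j}c_{j,l}\,\Gamma(l+\tfrac12)(l+g+\tfrac12)^{-(l+1/2)}e^{l+g+1/2}$, and $c_{j,l}$ is the coefficient of $x^{2l}$ in the Chebyshev polynomial $T_{2j}$. Let $$\mathsf{LogFactorial}(k)=\tfrac12\mathsf{Log}(2\pi)+(k+\tfrac12)\mathsf{Log}(k+g+\tfrac12)-(k+g+\tfrac12)+\mathsf{Log}(A_{t,g}(k)).$$ For $n\ge1$, $p\in(0,1)$ and $0\le k\le n$ let $\mathsf b_{n,p}(k)=\binom nk p^k(1-p)^{n-k}$, and let $$\mathsf b^{\mathsf{Inter}}_{n,p}(k)=\frac{\mathsf{Fact}(n)}{\mathsf{Fact}(k)\,\mathsf{Fact}(n-k)}\,p^k(1-p)^{n-k}$$ be the intermediate mass function, in which only the factorials are approximated (it is not renormalised). Let $\mathsf h$ be a hat function with rejection rate $\alpha>0$, that is, $0\le\mathsf h(k)\le1$ and $\mathsf b_{n,p}(k)\le\alpha\,\mathsf h(k)$ for $0\le k\le n$; every probability distribution dominating $\mathsf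 b_{n,p}$ in this way is one. The sampler evaluates $1/\mathsf h(k)$ as $\mathsf h^{-1}(u)=E(n,p,u)$ at a sample point $u\in[-\frac12,\frac12]$, where $E$ is a fixed arithmetic expression built from $n,p,u$ and real constants by finitely many operations $+,-,\times,/,\sqrt{\ }$ and absolute values. Its computed value $\widetilde{\mathsf h^{-1}}(u)$ is obtained by rounding all inputs and constants and performing all operations other than the (exact) absolute values by their rounded versions. For a constant $K$, call the evaluation of $E$ at $(n,p,u)$ *$K$-well-conditioned* if no divisor is zero, no argument of a square root is negative, and at every addition or subtraction of subexpressions with exact values $x,y$ one has $|x|+|y|\le K\,|x\pm y|$. The computed rejection ratio is $\widetilde r_k=e^{l_v}$ where, with operations performed from left to right, $$l_v=\mathsf{LogFactorial}(n)\ominus\mathsf{LogFactorial}(k)\ominus\mathsf{LogFactorial}(n-k)\oplus k\otimes\mathsf{Log}(p)\oplus(n-k)\otimes\mathsf{Log}(1-p)\oplus\mathsf{Log}\bigl(\widetilde{\mathsf h^{-1}}(u)\bigr)\ominus\mathsf{Log}(\alpha),$$ and the intermediate ratio is $r^{\mathsf{Inter}}_k=\dfrac{\mathsf b^{\mathsf{Inter}}_{n,p}(k)}{\alpha\,\mathsf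 h(k)}$. **Lemma.** Fix $t$, $g$, $E$, $K$ and $\alpha_{\max}$. There is a function $R(\beta)=o(\varepsilon)$ as $\beta\to\infty$, depending only on these data, such that for all sufficiently large $\beta$ (also depending only on these data) the following holds. For every rounding $\mathrm{rnd}$, every $n\ge1$ and $p\in(0,1)$ with $$\beta\ge\max\bigl(2\lceil\log_2 n\rceil,\ \lceil-\log_2p\rceil,\ \lceil-\log_2(1-p)\rceil\bigr)$$ and $A_{t,g}(j)>0$ for $0\le j\le n$, every hat function $\mathsf h$ with rejection rate $\alpha\le\alpha_{\max}$, every $k\in\{0,\dots,n\}$, and every $u\in[-\frac12,\frac12]$ such that $E(n,p,u)=1/\mathsf h(k)$ and the evaluation of $E$ at $(n,p,u)$ is $K$-well-conditioned, $$\left|\frac{\widetilde r_k}{r^{\mathsf{Inter}}_k}-1\right|\le(1110\,n+2540)\,\beta\,\varepsilon+14\,\varepsilon\log(\mathsf h(k))+R(\beta).$$ -/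

import Mathlib

open Filter Asymptotics

noncomputable section

namespace BinSamp

/-! ### Floating-point arithmetic of precision `β` -/

/-- The unit round-off `ε = 2^{-β}`. -/
def eps (β : ℕ) : ℝ := 1 / 2 ^ β

/-- Numbers `m · 2 ^ e` whose significand has at most `β` bits (with unbounded exponent).
The nonzero ones are the numbers `w · 2 ^ e` with `1/2 ≤ |w| ≤ 1` and `w` a multiple
of `2 ^ (-β)`. -/
def floats (β : ℕ) : Set ℝ :=
  {x | ∃ m e : ℤ, |m| ≤ 2 ^ β ∧ x = (m : ℝ) * (2 : ℝ) ^ e}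

/-- `rnd` rounds every real number to a nearest number of precision `β`
(ties are broken in an arbitrary way). -/
structure IsRounding (β : ℕ) (rnd : ℝ → ℝ) : Prop where
  mem : ∀ x, rnd x ∈ floats β
  nearest : ∀ x, ∀ y ∈ floats β, |rnd x - x| ≤ |y - x|

/-- Correctly rounded addition `⊕`. -/
def fadd (rnd : ℝ → ℝ) (x y : ℝ) : ℝ := rnd (rnd x + rnd y)

/-- Correctly rounded subtraction `⊖`. -/
def fsub (rnd : ℝ → ℝ) (x y : ℝ) : ℝ := rnd (rnd x - rnd y)

/-- Correctly rounded multiplication `⊗`. -/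
def fmul (rnd : ℝ → ℝ) (x y : ℝ) : ℝ := rnd (rnd x * rnd y)

/-- Correctly rounded division. -/
def fdiv (rnd : ℝ → ℝ) (x y : ℝ) : ℝ := rnd (rnd x / rnd y)

/-- Correctly rounded square root. -/
def fsqrt (rnd : ℝ → ℝ) (x : ℝ) : ℝ := rnd (Real.sqrt (rnd x))

/-! ### The logarithm computed by the arithmetic-geometric mean -/

/-- The arithmetic-geometric mean of two nonnegative real numbers. -/
def AGM (x y : ℝ) : ℝ := (NNReal.agm x.toNNReal y.toNNReal : ℝ)

/-- The exponent `e` of `x = w · 2 ^ e > 0`, where `1/2 ≤ w < 1`. -/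
def exponent (x : ℝ) : ℤ := Int.log 2 x + 1

/-- The scaling exponent `m = ⌈(β + 3) / 2⌉ - exponent x`. -/
def scaling (β : ℕ) (x : ℝ) : ℤ := ⌈((β : ℝ) + 3) / 2⌉ - exponent x

/-- The computed natural logarithm `π / (2 AGM(1, 4 / s)) - m log 2`, with `s = x · 2 ^ m`. -/
def agmLog (β : ℕ) (x : ℝ) : ℝ :=
  Real.pi / (2 * AGM 1 (4 / (x * (2 : ℝ) ^ scaling β x))) - (scaling β x : ℝ) * Real.log 2

/-! ### The Lanczos approximation of the factorial -/

/-- The coefficients `p_j(g)` of the Lanczos series. -/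
def lanczosCoeff (g : ℝ) (j : ℕ) : ℝ :=
  Real.sqrt 2 / Real.pi * ∑ l ∈ Finset.range (j + 1),
    (Polynomial.Chebyshev.T ℝ (2 * (j : ℤ))).coeff (2 * l) * Real.Gamma ((l : ℝ) + 1 / 2)
      * ((l : ℝ) + g + 1 / 2) ^ (-((l : ℝ) + 1 / 2)) * Real.exp ((l : ℝ) + g + 1 / 2)

/-- The Lanczos series `A_{t,g}(k)` truncated to its first `t` terms:
`p_0/2 + p_1 k/(k+1) + p_2 k(k-1)/((k+1)(k+2)) + ⋯`. -/
def lanczosA (t : ℕ) (g : ℝ) (k : ℕ) : ℝ :=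
  ∑ j ∈ Finset.range t, (if j = 0 then 1 / 2 else 1) * lanczosCoeff g j
    * ∏ i ∈ Finset.range j, ((k : ℝ) - i) / ((k : ℝ) + i + 1)

/-- The Lanczos approximation of `k!`. -/
def factLancz (t : ℕ) (g : ℝ) (k : ℕ) : ℝ :=
  Real.sqrt (2 * Real.pi) * ((k : ℝ) + g + 1 / 2) ^ ((k : ℝ) + 1 / 2)
    * Real.exp (-((k : ℝ) + g + 1 / 2)) * lanczosA t g k

/-- The logarithm of the Lanczos approximation of `k!`, with computed logarithms. -/
def logFactorial (β t : ℕ) (g : ℝ) (k : ℕ) : ℝ :=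
  1 / 2 * agmLog β (2 * Real.pi) + ((k : ℝ) + 1 / 2) * agmLog β ((k : ℝ) + g + 1 / 2)
    - ((k : ℝ) + g + 1 / 2) + agmLog β (lanczosA t g k)

/-! ### Hat functions built from basic arithmetic operations -/

/-- Arithmetic expressions in the parameters `n`, `p` and the uniform sample `u`. -/
inductive HatExpr : Type
  | const (r : ℝ)
  | n
  | p
  | u
  | abs (a : HatExpr)
  | add (a b : HatExpr)
  | sub (a b : HatExpr)
  | mul (a b : HatExpr)
  | div (a b : HatExpr)
  | sqrt (a : HatExpr)

/-- The exact value of an expression. -/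
def HatExpr.eval (N : ℕ) (P U : ℝ) : HatExpr → ℝ
  | .const r => r
  | .n => N
  | .p => P
  | .u => U
  | .abs a => |a.eval N P U|
  | .add a b => a.eval N P U + b.eval N P U
  | .sub a b => a.eval N P U - b.eval N P U
  | .mul a b => a.eval N P U * b.eval N P U
  | .div a b => a.eval N P U / b.eval N P U
  | .sqrt a => Real.sqrt (a.eval N P U)

/-- The value of an expression computed in floating-point arithmetic: inputs and constants are
rounded, and every operation is correctly rounded (absolute values are exact). -/
def HatExpr.fleval (rnd : ℝ → ℝ) (N : ℕ) (P U : ℝ) : HatExpr → ℝ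
  | .const r => rnd r
  | .n => rnd N
  | .p => rnd P
  | .u => rnd U
  | .abs a => |a.fleval rnd N P U|
  | .add a b => fadd rnd (a.fleval rnd N P U) (b.fleval rnd N P U)
  | .sub a b => fsub rnd (a.fleval rnd N P U) (b.fleval rnd N P U)
  | .mul a b => fmul rnd (a.fleval rnd N P U) (b.fleval rnd N P U)
  | .div a b => fdiv rnd (a.fleval rnd N P U) (b.fleval rnd N P U)
  | .sqrt a => fsqrt rnd (a.fleval rnd N P U)

/-- The exact evaluation is well defined (no division by zero, no root of a negative number) and
free of catastrophic cancellation: each sum and difference has condition number at most `K`. -/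
def HatExpr.WellConditioned (K : ℝ) (N : ℕ) (P U : ℝ) : HatExpr → Prop
  | .const _ => True
  | .n => True
  | .p => True
  | .u => True
  | .abs a => a.WellConditioned K N P U
  | .add a b => a.WellConditioned K N P U ∧ b.WellConditioned K N P U ∧
      |a.eval N P U| + |b.eval N P U| ≤ K * |a.eval N P U + b.eval N P U|
  | .sub a b => a.WellConditioned K N P U ∧ b.WellConditioned K N P U ∧
      |a.eval N P U| + |b.eval N P U| ≤ K * |a.eval N P U - b.eval N P U|
  | .mul a b => a.WellConditioned K N P U ∧ b.WellConditioned K N P U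
  | .div a b => a.WellConditioned K N P U ∧ b.WellConditioned K N P U ∧ b.eval N P U ≠ 0
  | .sqrt a => a.WellConditioned K N P U ∧ 0 ≤ a.eval N P U

/-! ### Rejection ratios -/

/-- The binomial probability mass function. -/
def binom (n : ℕ) (p : ℝ) (k : ℕ) : ℝ := (n.choose k : ℝ) * p ^ k * (1 - p) ^ (n - k)

/-- The intermediate mass function: the binomial one with the three factorials replaced by
their Lanczos approximations. -/
def binomInter (t : ℕ) (g : ℝ) (n : ℕ) (p : ℝ) (k : ℕ) : ℝ :=
  factLancz t g n / (factLancz t g k * factLancz t g (n - k)) * p ^ k * (1 - p) ^ (n - k)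

/-- `h` takes values in `[0, 1]` on `{0, …, n}` and dominates the binomial mass function there
with rejection rate `α`. This holds for each probability distribution `h` that is a hat
distribution with rejection rate `α`. -/
structure IsHat (n : ℕ) (p α : ℝ) (h : ℕ → ℝ) : Prop where
  rate_pos : 0 < α
  nonneg : ∀ k ≤ n, 0 ≤ h k
  le_one : ∀ k ≤ n, h k ≤ 1
  dominates : ∀ k ≤ n, binom n p k ≤ α * h k

/-- The ratio of the intermediate mass function to the scaled hat. -/
def ratioInter (t : ℕ) (g : ℝ) (n : ℕ) (p α : ℝ) (h : ℕ → ℝ) (k : ℕ) : ℝ :=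
  binomInter t g n p k / (α * h k)

/-- The quantity `l_v` computed by the sampler, where `x` is the computed value of `h⁻¹(u)`:
`l_n ⊖ l_k ⊖ l_{n-k} ⊕ k ⊗ Log p ⊕ (n-k) ⊗ Log (1-p) ⊕ Log x ⊖ Log α`, from left to right. -/
def logRatio (rnd : ℝ → ℝ) (β t : ℕ) (g : ℝ) (n : ℕ) (p α x : ℝ) (k : ℕ) : ℝ :=
  fsub rnd
    (fadd rnd
      (fadd rnd
        (fadd rnd
          (fsub rnd
            (fsub rnd (logFactorial β t g n) (logFactorial β t g k))
            (logFactorial β t g (n - k)))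
          (fmul rnd (k : ℝ) (agmLog β p)))
        (fmul rnd ((n - k : ℕ) : ℝ) (agmLog β (1 - p))))
      (agmLog β x))
    (agmLog β α)

/-- The computed rejection ratio, represented by the sampler through its logarithm `l_v`;
the hat function is the arithmetic expression `E`, evaluated at `u`. -/
def computedRatio (rnd : ℝ → ℝ) (β t : ℕ) (g : ℝ) (n : ℕ) (p α : ℝ) (E : HatExpr) (u : ℝ)
    (k : ℕ) : ℝ :=
  Real.exp (logRatio rnd β t g n p α (E.fleval rnd n p u) k)

end BinSamp

end

noncomputable section

namespace BinSamp

/-! The exact value of `l_v` is the logarithm of the intermediate ratio, so it suffices to bound the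
absolute error Δ of the computed `l_v` and to use |e^Δ − 1| ≤ 2|Δ| for |Δ| ≤ 1.

The computed logarithm has absolute error at most 10βε (`abs_agmLog_sub_log_le`). This rests on
Gauss's theory of the AGM. The squares of θ(q) and θ(−q) are carried to those of θ(q²) and θ(−q²) by
one AGM step, so their AGM is 1. Jacobi's inversion turns this into π = −4 log x · AGM(θ(x⁴)², (θ(x)
− θ(x⁴))²), where the quotient y of the two arguments is about 4x². Hence π/(2 AGM(1, y)) differs
from log(4/y) by O(y² log(1/y)), and the scaling makes y² = O(ε).

Every summand of `l_v` has size O(nβ): p and 1 − p are at least 2^(−β), the logarithm of the Lanczos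
series is at most linear in its argument (`exists_abs_log_lanczosA_le`), and h(k) is bounded below
by domination of the binomial mass. Each rounding therefore costs O(nβε). The hat expression has
relative error O(ε), which its logarithm turns into an absolute error below βε for large β. In total
|Δ| ≤ 331nβε (`approx_logRatio`). This is at most 1 because n²ε ≤ 1 and β²ε → 0.

Since log h(k) ≥ −2nβ, the term 14ε log h(k) lowers the bound by at most 28nβε, and 2 · 331 + 28 <
1110. No remainder R is needed. -/

/-! ### Theta series: bounds, continuity and quadratic identities -/

/-- The theta series `∑ q ^ (n ^ 2)` over the integers; at `-q` it is the alternating one. -/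
def theta (q : ℝ) : ℝ := ∑' n : ℤ, q ^ (n.natAbs ^ 2)

theorem summable_pow_sq {q : ℝ} (hq : |q| < 1) : Summable fun n : ℕ => q ^ (n ^ 2) := by
  refine Summable.of_norm_bounded (summable_geometric_of_lt_one (abs_nonneg q) hq) fun n => ?_
  rw [norm_pow, Real.norm_eq_abs]
  exact pow_le_pow_of_le_one (abs_nonneg q) hq.le (Nat.le_self_pow two_ne_zero n)

theorem summable_pow_natAbs_sq {q : ℝ} (hq : |q| < 1) :
    Summable fun n : ℤ => q ^ (n.natAbs ^ 2) := by
  have h := summable_pow_sq hq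
  exact Summable.of_nat_of_neg (by simpa using h) (by simpa using h)

theorem theta_eq_nat {q : ℝ} (hq : |q| < 1) : theta q = 1 + 2 * ∑' n : ℕ, q ^ ((n + 1) ^ 2) := by
  have h := tsum_of_nat_of_neg_add_one (f := fun n : ℤ => q ^ (n.natAbs ^ 2))
  have hs := summable_pow_sq hq
  have e : ∀ n : ℕ, (-((n : ℤ) + 1)).natAbs = n + 1 := fun n => by omega
  simp only [Int.natAbs_natCast, e] at h
  have h1 := hs.tsum_eq_zero_add
  rw [theta, h hs ((summable_nat_add_iff (f := fun n : ℕ => q ^ (n ^ 2)) 1).2 hs), h1,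
    zero_pow two_ne_zero, pow_zero]
  ring

theorem pow_succ_sq_le {q : ℝ} (h0 : 0 ≤ q) (h1 : q ≤ 1) (n : ℕ) :
    q ^ ((n + 1) ^ 2) ≤ q * q ^ n := by
  rw [← pow_succ']
  exact pow_le_pow_of_le_one h0 h1 (Nat.le_self_pow two_ne_zero _)

theorem summable_pow_succ_sq {q : ℝ} (h0 : 0 ≤ q) (h1 : q < 1) :
    Summable fun n : ℕ => q ^ ((n + 1) ^ 2) :=
  Summable.of_nonneg_of_le (fun n => by positivity) (pow_succ_sq_le h0 h1.le)
    ((summable_geometric_of_lt_one h0 h1).mul_left q)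

theorem one_le_theta {q : ℝ} (h0 : 0 ≤ q) (h1 : q < 1) : 1 ≤ theta q := by
  rw [theta_eq_nat (by rwa [abs_of_nonneg h0])]
  have : 0 ≤ ∑' n : ℕ, q ^ ((n + 1) ^ 2) := tsum_nonneg fun n => by positivity
  linarith

theorem theta_le {q : ℝ} (h0 : 0 ≤ q) (h1 : q ≤ 1 / 2) : theta q ≤ 1 + 4 * q := by
  have hq : q < 1 := by linarith
  rw [theta_eq_nat (by rwa [abs_of_nonneg h0])]
  have h := (summable_pow_succ_sq h0 hq).tsum_le_tsum (pow_succ_sq_le h0 hq.le)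
    ((summable_geometric_of_lt_one h0 hq).mul_left q)
  rw [tsum_mul_left, tsum_geometric_of_lt_one h0 hq] at h
  have : (1 - q)⁻¹ ≤ 2 := by
    rw [inv_le_comm₀ (by linarith) two_pos]; linarith
  nlinarith

theorem continuousOn_theta : ContinuousOn theta (Set.Icc (-(1 / 2)) (1 / 2)) := by
  have h : ContinuousOn (fun q : ℝ => 1 + 2 * ∑' n : ℕ, q ^ ((n + 1) ^ 2))
      (Set.Icc (-(1 / 2)) (1 / 2)) := by
    refine continuousOn_const.add (continuousOn_const.mul ?_)
    refine continuousOn_tsum (u := fun n : ℕ => (1 / 2 : ℝ) ^ n) (fun n => by fun_prop)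
      (summable_geometric_of_lt_one (by norm_num) (by norm_num)) fun n q hq => ?_
    rw [norm_pow, Real.norm_eq_abs]
    have hq' : |q| ≤ 1 / 2 := abs_le.2 hq
    calc |q| ^ ((n + 1) ^ 2) ≤ (1 / 2) ^ ((n + 1) ^ 2) := by gcongr
      _ ≤ (1 / 2) ^ n := pow_le_pow_of_le_one (by norm_num) (by norm_num) (by nlinarith)
  refine h.congr fun q hq => theta_eq_nat ?_
  have : |q| ≤ 1 / 2 := abs_le.2 hq
  linarith

theorem theta_zero : theta 0 = 1 := by
  rw [theta_eq_nat (by simp)]; simp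

/-- The terms with odd index of the theta series. -/
theorem theta_sub_theta_pow_four {q : ℝ} (hq : |q| < 1) :
    theta q - theta (q ^ 4) = 2 * ∑' n : ℕ, q ^ ((2 * n + 1) ^ 2) := by
  have hq4 : |q ^ 4| < 1 := by rw [abs_pow]; exact pow_lt_one₀ (abs_nonneg q) hq (by norm_num)
  have hs : Summable fun n : ℕ => q ^ ((n + 1) ^ 2) :=
    (summable_nat_add_iff (f := fun n : ℕ => q ^ (n ^ 2)) 1).2 (summable_pow_sq hq)
  rw [theta_eq_nat hq, theta_eq_nat hq4,
    ← tsum_even_add_odd (f := fun n : ℕ => q ^ ((n + 1) ^ 2))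
      (hs.comp_injective (i := fun n : ℕ => 2 * n) fun a b h => by simpa using h)
      (hs.comp_injective (i := fun n : ℕ => 2 * n + 1) fun a b h => by simpa using h)]
  have : ∀ n : ℕ, (q ^ 4) ^ ((n + 1) ^ 2) = q ^ ((2 * n + 1 + 1) ^ 2) := fun n => by
    rw [← pow_mul]; congr 1; ring
  simp only [this]
  ring

theorem two_mul_le_theta_sub {x : ℝ} (h0 : 0 ≤ x) (h1 : x ≤ 1 / 2) :
    2 * x ≤ theta x - theta (x ^ 4) ∧ theta x - theta (x ^ 4) ≤ 2 * x * (1 + 2 * x ^ 4) := by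
  have hx : |x| < 1 := by rw [abs_of_nonneg h0]; linarith
  have h4 : x ^ 4 ≤ 1 / 2 := by
    calc x ^ 4 ≤ (1 / 2) ^ 4 := by gcongr
      _ ≤ 1 / 2 := by norm_num
  have h40 : 0 ≤ x ^ 4 := by positivity
  have hb : ∀ n : ℕ, x ^ ((2 * n + 1) ^ 2) ≤ x * (x ^ 4) ^ n := fun n => by
    rw [← pow_mul, ← pow_succ']
    exact pow_le_pow_of_le_one h0 (by linarith) (by nlinarith)
  have hg := (summable_geometric_of_lt_one h40 (by linarith)).mul_left x
  have hs : Summable fun n : ℕ => x ^ ((2 * n + 1) ^ 2) :=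
    Summable.of_nonneg_of_le (fun n => by positivity) hb hg
  rw [theta_sub_theta_pow_four hx]
  constructor
  · have := hs.le_tsum 0 fun n _ => by positivity
    simp only [mul_zero, zero_add, one_pow, pow_one] at this
    linarith
  · have h := hs.tsum_le_tsum hb hg
    rw [tsum_mul_left, tsum_geometric_of_lt_one h40 (by linarith)] at h
    have : (1 - x ^ 4)⁻¹ ≤ 1 + 2 * x ^ 4 := by
      rw [inv_le_iff_one_le_mul₀ (by linarith)]; nlinarith
    nlinarith

theorem theta_neg_add {q : ℝ} (hq : |q| < 1) : theta q + theta (-q) = 2 * theta (q ^ 4) := by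
  have h1 := theta_sub_theta_pow_four hq
  have h2 := theta_sub_theta_pow_four (q := -q) (by rwa [abs_neg])
  have : ∀ n : ℕ, (-q) ^ ((2 * n + 1) ^ 2) = - q ^ ((2 * n + 1) ^ 2) := fun n =>
    Odd.neg_pow (Odd.pow ⟨n, rfl⟩) q
  simp only [this, tsum_neg, Even.neg_pow (show Even 4 by decide)] at h2
  linarith

/-- The map (a, b) ↦ (a + b, a − b) is injective with image the pairs of equal parity, and the
weight is the indicator of that image. -/
theorem tsum_add_sub {f : ℤ × ℤ → ℝ} :
    ∑' a : ℤ × ℤ, f (a.1 + a.2, a.1 - a.2)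
      = ∑' m : ℤ × ℤ, (1 + (-1 : ℝ) ^ (m.1.natAbs + m.2.natAbs)) / 2 * f m := by
  have hi : Function.Injective fun a : ℤ × ℤ => (a.1 + a.2, a.1 - a.2) := fun a b h => by
    simp only [Prod.mk.injEq] at h
    ext <;> omega
  rw [← hi.tsum_eq (f := fun m : ℤ × ℤ =>
    (1 + (-1 : ℝ) ^ (m.1.natAbs + m.2.natAbs)) / 2 * f m)]
  · refine tsum_congr fun a => ?_
    have : Even ((a.1 + a.2).natAbs + (a.1 - a.2).natAbs) := by
      rw [Nat.even_add, Int.natAbs_even, Int.natAbs_even, Int.even_add, Int.even_sub]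
    simp [this.neg_one_pow]
  · intro m hm
    have : Even (m.1.natAbs + m.2.natAbs) := by
      by_contra h
      rw [Nat.not_even_iff_odd] at h
      simp [h.neg_one_pow] at hm
    rw [Nat.even_add, Int.natAbs_even, Int.natAbs_even, ← Int.even_add] at this
    obtain ⟨c, hc⟩ := this
    exact ⟨(c, m.1 - c), by ext <;> simp only <;> omega⟩

theorem neg_pow_natAbs_sq (q : ℝ) (n : ℕ) : (-q) ^ (n ^ 2) = (-1) ^ n * q ^ (n ^ 2) := by
  rw [neg_pow]
  congr 1
  rcases Nat.even_or_odd n with h | h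
  · rw [h.neg_one_pow, (h.pow_of_ne_zero two_ne_zero).neg_one_pow]
  · rw [h.neg_one_pow, h.pow.neg_one_pow]

theorem theta_mul_theta {q r : ℝ} (hq : |q| < 1) (hr : |r| < 1) :
    Summable (fun m : ℤ × ℤ => q ^ (m.1.natAbs ^ 2) * r ^ (m.2.natAbs ^ 2)) ∧
    theta q * theta r = ∑' m : ℤ × ℤ, q ^ (m.1.natAbs ^ 2) * r ^ (m.2.natAbs ^ 2) := by
  have hs := summable_mul_of_summable_norm (summable_pow_natAbs_sq hq).norm
    (summable_pow_natAbs_sq hr).norm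
  exact ⟨hs, (summable_pow_natAbs_sq hq).tsum_mul_tsum (summable_pow_natAbs_sq hr) hs⟩

/-- From (a + b)² + (a − b)² = 2a² + 2b², the double series of θ(sq)² is that of θ(s)θ(q) restricted
to indices of equal parity; averaging with the series at −s, −q performs the restriction. The cases
s = q and s = −q give the arithmetic and the geometric mean. -/
theorem theta_sq {q s : ℝ} (hq : |q| < 1) (hs : s = q ∨ s = -q) :
    theta (s * q) ^ 2 = (theta s * theta q + theta (-s) * theta (-q)) / 2 := by
  have hs1 : |s| < 1 := by rcases hs with rfl | rfl <;> simpa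
  have hsq : |s * q| < 1 := by
    rw [abs_mul]; nlinarith [abs_nonneg s, abs_nonneg q]
  obtain ⟨s1, e1⟩ := theta_mul_theta hs1 hq
  obtain ⟨s2, e2⟩ := theta_mul_theta (q := -s) (r := -q) (by simpa) (by simpa)
  rw [sq, (theta_mul_theta hsq hsq).2, e1, e2, ← s1.tsum_add s2, ← tsum_div_const]
  have key := tsum_add_sub (f := fun m : ℤ × ℤ => s ^ (m.1.natAbs ^ 2) * q ^ (m.2.natAbs ^ 2))
  have hr : ∀ m : ℤ × ℤ, (1 + (-1 : ℝ) ^ (m.1.natAbs + m.2.natAbs)) / 2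
      * (s ^ (m.1.natAbs ^ 2) * q ^ (m.2.natAbs ^ 2))
      = (s ^ (m.1.natAbs ^ 2) * q ^ (m.2.natAbs ^ 2)
        + (-s) ^ (m.1.natAbs ^ 2) * (-q) ^ (m.2.natAbs ^ 2)) / 2 := fun m => by
    rw [neg_pow_natAbs_sq, neg_pow_natAbs_sq, pow_add]; ring
  simp only [hr] at key
  rw [← key]
  refine tsum_congr fun a => ?_
  have e : (a.1 + a.2).natAbs ^ 2 + (a.1 - a.2).natAbs ^ 2
      = 2 * a.1.natAbs ^ 2 + 2 * a.2.natAbs ^ 2 := by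
    zify; simp only [sq_abs]; ring
  rcases hs with rfl | rfl
  · rw [← pow_add, ← pow_add, e, ← sq, ← pow_mul, mul_add]
  · have hn : ∀ n : ℕ, (-q * q) ^ n = (-1) ^ n * q ^ (2 * n) := fun n => by
      rw [pow_mul, ← mul_pow]; congr 1; ring
    have hp : (-1 : ℝ) ^ ((a.1 + a.2).natAbs) = (-1) ^ (a.1.natAbs ^ 2 + a.2.natAbs ^ 2) := by
      have : Even ((a.1 + a.2).natAbs) ↔ Even (a.1.natAbs ^ 2 + a.2.natAbs ^ 2) := by
        rw [Nat.even_add, Int.natAbs_even, Int.even_add, Nat.even_pow' two_ne_zero,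
          Nat.even_pow' two_ne_zero, Int.natAbs_even, Int.natAbs_even]
      by_cases h : Even ((a.1 + a.2).natAbs)
      · rw [h.neg_one_pow, (this.1 h).neg_one_pow]
      · rw [(Nat.not_even_iff_odd.1 h).neg_one_pow,
          (Nat.not_even_iff_odd.1 (mt this.2 h)).neg_one_pow]
    rw [neg_pow_natAbs_sq, mul_assoc, ← pow_add q, e, hp, ← pow_add (-q * q), hn]
    congr 2
    ring

theorem theta_sq_add {q : ℝ} (hq : |q| < 1) :
    theta (q ^ 2) ^ 2 = (theta q ^ 2 + theta (-q) ^ 2) / 2 := by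
  have := theta_sq hq (Or.inl rfl)
  rw [← sq] at this; rw [this]; ring

theorem theta_mul_theta_neg {q : ℝ} (hq : |q| < 1) :
    theta (-q ^ 2) ^ 2 = theta q * theta (-q) := by
  have := theta_sq hq (Or.inr rfl)
  rw [neg_neg, show -q * q = -q ^ 2 by ring] at this
  rw [this]; ring

/-! ### The arithmetic-geometric mean of theta values -/

theorem AGM_theta_step {q : ℝ} (hq : |q| < 1) :
    AGM (theta q ^ 2) (theta (-q) ^ 2) = AGM (theta (q ^ 2) ^ 2) (theta (-q ^ 2) ^ 2) := by
  unfold AGM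
  rw [NNReal.agm_eq_agm_gm_am, NNReal.agm_comm]
  congr 2
  · rw [theta_sq_add hq, Real.toNNReal_div (by positivity),
      Real.toNNReal_add (by positivity) (by positivity)]
    simp
  · rw [← Real.toNNReal_mul (by positivity), ← mul_pow, ← theta_mul_theta_neg hq]
    rw [NNReal.sqrt_eq_iff_eq_sq, Real.toNNReal_pow (by positivity)]

theorem AGM_theta_iterate {q : ℝ} (h0 : 0 ≤ q) (h1 : q < 1) (n : ℕ) :
    AGM (theta q ^ 2) (theta (-q) ^ 2)
      = AGM (theta (q ^ 2 ^ n) ^ 2) (theta (-q ^ 2 ^ n) ^ 2) := by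
  induction n with
  | zero => simp
  | succ n ih =>
    rw [ih, AGM_theta_step, ← pow_mul, ← pow_succ]
    rw [abs_of_nonneg (by positivity)]
    exact pow_lt_one₀ h0 h1 (by positivity)

theorem min_le_AGM {a b : ℝ} (ha : 0 ≤ a) (hb : 0 ≤ b) : min a b ≤ AGM a b := by
  have h := NNReal.min_le_agm (x := a.toNNReal) (y := b.toNNReal)
  rw [← NNReal.coe_le_coe, NNReal.coe_min, Real.coe_toNNReal a ha, Real.coe_toNNReal b hb] at h
  exact h

theorem AGM_le_max {a b : ℝ} (ha : 0 ≤ a) (hb : 0 ≤ b) : AGM a b ≤ max a b := by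
  have h := NNReal.agm_le_max (x := a.toNNReal) (y := b.toNNReal)
  rw [← NNReal.coe_le_coe, NNReal.coe_max, Real.coe_toNNReal a ha, Real.coe_toNNReal b hb] at h
  exact h

theorem AGM_mul {k a b : ℝ} (hk : 0 ≤ k) : AGM (k * a) (k * b) = k * AGM a b := by
  unfold AGM
  rw [Real.toNNReal_mul hk, Real.toNNReal_mul hk, NNReal.agm_mul_distrib, NNReal.coe_mul,
    Real.coe_toNNReal k hk]

/-- The AGM is constant along q ↦ q² and lies between the minimum and the maximum of its arguments,
both of which tend to θ(0)² = 1. -/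
theorem AGM_theta {q : ℝ} (h0 : 0 ≤ q) (h1 : q < 1) :
    AGM (theta q ^ 2) (theta (-q) ^ 2) = 1 := by
  have hc : ContinuousAt theta 0 :=
    continuousOn_theta.continuousAt (Icc_mem_nhds (by norm_num) (by norm_num))
  have hq : Tendsto (fun n : ℕ => q ^ 2 ^ n) atTop (nhds 0) :=
    (tendsto_pow_atTop_nhds_zero_of_lt_one h0 h1).comp
      (tendsto_pow_atTop_atTop_of_one_lt one_lt_two)
  have ht : Tendsto theta (nhds 0) (nhds 1) := by simpa [theta_zero] using hc.tendsto
  have ha : Tendsto (fun n : ℕ => theta (q ^ 2 ^ n) ^ 2) atTop (nhds 1) := by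
    simpa using (ht.comp hq).pow 2
  have hb : Tendsto (fun n : ℕ => theta (-q ^ 2 ^ n) ^ 2) atTop (nhds 1) := by
    have : Tendsto (fun n : ℕ => -q ^ 2 ^ n) atTop (nhds 0) := by simpa using hq.neg
    simpa using (ht.comp this).pow 2
  refine le_antisymm ?_ ?_
  · refine ge_of_tendsto' (by simpa using ha.max hb) fun n => ?_
    rw [AGM_theta_iterate h0 h1 n]
    exact AGM_le_max (by positivity) (by positivity)
  · refine le_of_tendsto' (by simpa using ha.min hb) fun n => ?_
    rw [AGM_theta_iterate h0 h1 n]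
    exact min_le_AGM (by positivity) (by positivity)

/-- Jacobi's inversion formula, a case of Poisson summation. -/
theorem theta_exp {T : ℝ} (hT : 0 < T) :
    theta (Real.exp (-Real.pi * T⁻¹)) = √T * theta (Real.exp (-Real.pi * T)) := by
  have h := Real.tsum_exp_neg_mul_int_sq (inv_pos.2 hT)
  have e : ∀ a : ℝ, theta (Real.exp (-Real.pi * a))
      = ∑' n : ℤ, Real.exp (-Real.pi * a * (n : ℝ) ^ 2) := fun a => by
    refine tsum_congr fun n => ?_
    rw [← Real.exp_nat_mul]
    congr 1
    push_cast [Nat.cast_natAbs]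
    rw [sq_abs]
    ring
  rw [e, e, h, Real.inv_rpow hT.le, one_div, inv_inv, Real.sqrt_eq_rpow, div_inv_eq_mul]

/-- Gauss's evaluation of the arithmetic-geometric mean by theta series, in the nome dual to the
one in which the arithmetic-geometric iteration acts by squaring. -/
theorem neg_log_mul_AGM {x : ℝ} (h0 : 0 < x) (h1 : x < 1) :
    -4 * Real.log x * AGM (theta (x ^ 4) ^ 2) ((theta x - theta (x ^ 4)) ^ 2) = Real.pi := by
  -- With this T, the nome x⁴ = e^(−πT) is dual to q = e^(−π/T), and x is dual to q⁴.
  obtain ⟨T, hT, rfl⟩ : ∃ T : ℝ, 0 < T ∧ x = Real.exp (-Real.pi * (T / 4)) := by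
    refine ⟨-4 * Real.log x / Real.pi,
      div_pos (by linarith [Real.log_neg h0 h1]) Real.pi_pos, ?_⟩
    rw [eq_comm, ← Real.exp_log h0]
    have := Real.pi_ne_zero
    simp only [Real.log_exp]
    congr 1
    field_simp
  have e4 : Real.exp (-Real.pi * (T / 4)) ^ 4 = Real.exp (-Real.pi * T) := by
    rw [← Real.exp_nat_mul]; congr 1; push_cast; ring
  set q := Real.exp (-Real.pi * T⁻¹) with hq
  have q0 : 0 ≤ q := (Real.exp_pos _).le
  have q1 : q < 1 := by
    rw [hq, Real.exp_lt_one_iff]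
    have := mul_pos Real.pi_pos (inv_pos.2 hT); linarith
  have q4 : q ^ 4 = Real.exp (-Real.pi * (T / 4)⁻¹) := by
    rw [hq, ← Real.exp_nat_mul]; congr 1; push_cast; field_simp
  have hs : √(T / 4) = √T / 2 := by
    rw [Real.sqrt_div hT.le, show (4 : ℝ) = 2 ^ 2 by norm_num, Real.sqrt_sq (by norm_num)]
  have a1 := theta_exp hT
  have a2 := theta_exp (show 0 < T / 4 by positivity)
  rw [← q4, hs] at a2
  have a3 := theta_neg_add (q := q) (by rwa [abs_of_nonneg q0])
  -- θ(−q) = 2θ(q⁴) − θ(q), and inversion sends θ(q⁴) to (√T/2)θ(x) and θ(q) to √T θ(x⁴).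
  have a4 : theta (-q) = √T * (theta (Real.exp (-Real.pi * (T / 4)))
      - theta (Real.exp (-Real.pi * T))) := by linarith
  have h := AGM_theta q0 q1
  rw [a4, a1, mul_pow, mul_pow, AGM_mul (by positivity), Real.sq_sqrt hT.le] at h
  rw [e4, Real.log_exp]
  linear_combination Real.pi * h

/-- With y = (φ/θ)², θ = θ(x⁴) and φ = θ(x) − θ(x⁴), the AGM quotient is exactly −2θ² log x. Also
log(4/y) is −2 log x up to the logarithms of θ and φ/(2x), which are O(x⁴) = O(y²). -/
theorem abs_pi_div_AGM_sub_log_le {y : ℝ} (h0 : 0 < y) (h1 : y ≤ 1 / 2) :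
    |Real.pi / (2 * AGM 1 y) - Real.log (4 / y)|
      ≤ y ^ 2 * (9 / 4 * Real.log (6 / y) + 2) := by
  have h4 : ∀ x : ℝ, 0 ≤ x → x ≤ 1 / 2 → x ^ 4 ≤ 1 / 16 := fun x hx hx' => by
    calc x ^ 4 ≤ (1 / 2) ^ 4 := by gcongr
      _ = 1 / 16 := by norm_num
  obtain ⟨x, ⟨x0, x1⟩, hx⟩ : ∃ x ∈ Set.Icc (0 : ℝ) (1 / 2),
      ((theta x - theta (x ^ 4)) / theta (x ^ 4)) ^ 2 = y := by
    have hc1 : ContinuousOn theta (Set.Icc 0 (1 / 2)) :=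
      continuousOn_theta.mono (Set.Icc_subset_Icc_left (by norm_num))
    have hc4 : ContinuousOn (fun x : ℝ => theta (x ^ 4)) (Set.Icc 0 (1 / 2)) :=
      hc1.comp (by fun_prop) fun x hx =>
        ⟨by positivity, (h4 x hx.1 hx.2).trans (by norm_num)⟩
    have hp : ∀ x ∈ Set.Icc (0 : ℝ) (1 / 2), theta (x ^ 4) ≠ 0 := fun x hx =>
      (zero_lt_one.trans_le (one_le_theta (q := x ^ 4) (by positivity)
        ((h4 x hx.1 hx.2).trans_lt (by norm_num)))).ne'
    refine intermediate_value_Icc (by norm_num) (((hc1.sub hc4).div hc4 hp).pow 2)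
      ⟨by simp [theta_zero, h0.le], h1.trans ?_⟩
    have a := (two_mul_le_theta_sub (x := 1 / 2) (by norm_num) le_rfl).1
    have b := theta_le (q := (1 / 2) ^ 4) (by norm_num) (by norm_num)
    have c := one_le_theta (q := (1 / 2) ^ 4) (by norm_num) (by norm_num)
    -- At x = 1/2 the numerator is at least 1 and the denominator at most 5/4; the square 16/25
    -- exceeds 1/2, so the intermediate value theorem reaches every y ≤ 1/2.
    have : (4 : ℝ) / 5 ≤ (theta (1 / 2) - theta ((1 / 2) ^ 4)) / theta ((1 / 2) ^ 4) := by
      rw [le_div_iff₀ (by linarith)]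
      linarith
    simp only [Pi.pow_apply, Pi.div_apply, Pi.sub_apply]
    nlinarith
  have xpos : 0 < x := by
    refine x0.lt_of_ne fun h => h0.ne ?_
    rw [← hx, ← h]
    simp [theta_zero]
  have X4 := h4 x x0 x1
  have X40 : 0 ≤ x ^ 4 := by positivity
  have key := neg_log_mul_AGM xpos (by linarith)
  obtain ⟨φl, φu⟩ := two_mul_le_theta_sub x0 x1
  have θl := one_le_theta X40 (by linarith)
  have θu := theta_le X40 (by linarith)
  set θ := theta (x ^ 4) with hθ
  set φ := theta x - θ with hφ
  have hφ2 : φ ^ 2 = θ ^ 2 * y := by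
    rw [← hx]; field_simp
  have hm : AGM (θ ^ 2) (θ ^ 2 * y) = θ ^ 2 * AGM 1 y := by
    simpa using AGM_mul (a := 1) (b := y) (sq_nonneg θ)
  rw [hφ2, hm] at key
  have hA : 0 < AGM 1 y :=
    (lt_min one_pos h0).trans_le (min_le_AGM zero_le_one h0.le)
  have e1 : Real.pi / (2 * AGM 1 y) = -2 * Real.log x * θ ^ 2 := by
    rw [div_eq_iff (by positivity), ← key]; ring
  have φ0 : 0 < φ := by linarith
  have e2 : Real.log (4 / y)
      = -2 * Real.log x + 2 * Real.log θ - 2 * Real.log (φ / (2 * x)) := by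
    have : 4 / y = (2 * θ / φ) ^ 2 := by
      have : y = φ ^ 2 / θ ^ 2 := by rw [hφ2]; field_simp
      rw [this]; field_simp; norm_num
    rw [this, Real.log_pow, Real.log_div (by positivity) φ0.ne', Real.log_div φ0.ne' (by positivity),
      Real.log_mul two_ne_zero (by positivity), Real.log_mul two_ne_zero xpos.ne']
    push_cast; ring
  have l1 : 0 ≤ Real.log θ := Real.log_nonneg θl
  have l2 : Real.log θ ≤ 4 * x ^ 4 := (Real.log_le_sub_one_of_pos (by linarith)).trans (by linarith)
  have l3 : 0 ≤ Real.log (φ / (2 * x)) := Real.log_nonneg (by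
    rw [le_div_iff₀ (by positivity)]; linarith)
  have l4 : Real.log (φ / (2 * x)) ≤ 2 * x ^ 4 := by
    refine (Real.log_le_sub_one_of_pos (by positivity)).trans ?_
    have : φ / (2 * x) ≤ 1 + 2 * x ^ 4 := by
      rw [div_le_iff₀ (by positivity)]; linarith
    linarith
  have y1 : 2 * x ^ 2 ≤ y := by
    have : θ ^ 2 * (2 * x ^ 2) ≤ θ ^ 2 * y := by
      rw [← hφ2]
      have : θ ^ 2 ≤ 2 := by nlinarith
      nlinarith [sq_nonneg x]
    exact le_of_mul_le_mul_left this (by positivity)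
  have y2 : y ≤ 6 * x ^ 2 := by
    have : y ≤ φ ^ 2 := by
      rw [hφ2]; exact le_mul_of_one_le_left h0.le (one_le_pow₀ θl)
    have : φ ≤ 9 / 4 * x := by nlinarith
    nlinarith
  have y4 : x ^ 4 ≤ y ^ 2 / 4 := by
    have := pow_le_pow_left₀ (by positivity) y1 2
    linarith
  have lx : -2 * Real.log x ≤ Real.log (6 / y) := by
    have : -2 * Real.log x = Real.log (1 / x ^ 2) := by
      rw [one_div, Real.log_inv, Real.log_pow]; push_cast; ring
    rw [this]
    apply Real.log_le_log (by positivity)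
    rw [div_le_div_iff₀ (by positivity) h0]; linarith
  have lx0 : 0 ≤ -2 * Real.log x := by
    have := Real.log_nonpos x0 (by linarith); linarith
  have θ2 : θ ^ 2 - 1 ≤ 9 * x ^ 4 := by
    have : θ ^ 2 ≤ (1 + 4 * x ^ 4) ^ 2 := by gcongr
    nlinarith
  have θ3 : 0 ≤ θ ^ 2 - 1 := sub_nonneg.2 (one_le_pow₀ θl)
  have m1 : -2 * Real.log x * (θ ^ 2 - 1) ≤ Real.log (6 / y) * (9 * (y ^ 2 / 4)) :=
    mul_le_mul lx (θ2.trans (by linarith)) θ3 (lx0.trans lx)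
  have m0 : 0 ≤ -2 * Real.log x * (θ ^ 2 - 1) := mul_nonneg lx0 θ3
  have m2 : 0 ≤ Real.log (6 / y) * y ^ 2 := mul_nonneg (lx0.trans lx) (sq_nonneg y)
  have e3 : -2 * Real.log x * θ ^ 2
      - (-2 * Real.log x + 2 * Real.log θ - 2 * Real.log (φ / (2 * x)))
      = -2 * Real.log x * (θ ^ 2 - 1) - 2 * Real.log θ + 2 * Real.log (φ / (2 * x)) := by ring
  rw [e1, e2, e3, abs_le]
  constructor <;> linarith

/-! ### Error of the computed logarithm, and rounding error -/

theorem eps_pos (β : ℕ) : 0 < eps β := by unfold eps; positivity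

theorem abs_agmLog_sub_log_le {β : ℕ} (hβ : 20 ≤ β) {x : ℝ} (hx : 0 < x) :
    |agmLog β x - Real.log x| ≤ 10 * β * eps β := by
  set c : ℤ := ⌈((β : ℝ) + 3) / 2⌉ with hc
  set m := scaling β x with hm
  set s := x * (2 : ℝ) ^ m with hs
  have hβ' : (20 : ℝ) ≤ β := by exact_mod_cast hβ
  have c1 : ((β : ℝ) + 3) / 2 ≤ c := Int.le_ceil _
  have c2 : (c : ℝ) < ((β : ℝ) + 3) / 2 + 1 := Int.ceil_lt_add_one _
  have hm' : m = c - (Int.log 2 x + 1) := rfl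
  have s1 : (2 : ℝ) ^ (c - 1) ≤ s := by
    have : c - 1 = Int.log 2 x + m := by rw [hm']; ring
    rw [this, zpow_add₀ two_ne_zero, hs]
    gcongr
    exact_mod_cast Int.zpow_log_le_self (b := 2) (by norm_num) hx
  have s2 : s ≤ (2 : ℝ) ^ c := by
    have : c = Int.log 2 x + 1 + m := by rw [hm']; ring
    rw [this, zpow_add₀ two_ne_zero, hs]
    gcongr
    exact_mod_cast (Int.lt_zpow_succ_log_self (b := 2) (by norm_num) x).le
  have s8 : 8 ≤ s := by
    refine le_trans ?_ s1
    have : (3 : ℤ) ≤ c - 1 := by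
      have : (4 : ℝ) ≤ c := by linarith
      have : (4 : ℤ) ≤ c := by exact_mod_cast this
      linarith
    calc (8 : ℝ) = 2 ^ (3 : ℤ) := by norm_num
      _ ≤ 2 ^ (c - 1) := zpow_le_zpow_right₀ one_le_two this
  -- As c − 1 ≥ (β + 1)/2, s² ≥ 2^(β+1). This is what the choice of the scaling exponent is for: y =
  -- 4/s then satisfies y² ≤ 8ε.
  have ss : 2 ≤ eps β * s ^ 2 := by
    have h : (2 : ℝ) ^ ((β : ℤ) + 1) ≤ s ^ 2 := by
      have : (β : ℤ) + 1 ≤ (c - 1) + (c - 1) := by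
        have : (β : ℝ) + 3 ≤ 2 * c := by linarith
        have : (β : ℤ) + 3 ≤ 2 * c := by exact_mod_cast this
        linarith
      calc (2 : ℝ) ^ ((β : ℤ) + 1) ≤ 2 ^ ((c - 1) + (c - 1)) := zpow_le_zpow_right₀ one_le_two this
        _ = (2 ^ (c - 1)) ^ 2 := by rw [zpow_add₀ two_ne_zero, sq]
        _ ≤ s ^ 2 := by gcongr
    rw [zpow_add₀ two_ne_zero, zpow_natCast, zpow_one] at h
    calc (2 : ℝ) = eps β * (2 ^ β * 2) := by unfold eps; field_simp
      _ ≤ eps β * s ^ 2 := by have := eps_pos β; gcongr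
  have s0 : 0 < s := by linarith
  have h := abs_pi_div_AGM_sub_log_le (y := 4 / s) (by positivity)
    (by rw [div_le_iff₀ s0]; linarith)
  have e1 : (4 : ℝ) / (4 / s) = s := by field_simp
  have e2 : (6 : ℝ) / (4 / s) = 3 / 2 * s := by field_simp; norm_num
  rw [e1, e2] at h
  have hlog : Real.log s = Real.log x + m * Real.log 2 := by
    rw [hs, Real.log_mul hx.ne' (by positivity), Real.log_zpow]
  have hL : agmLog β x - Real.log x = Real.pi / (2 * AGM 1 (4 / s)) - Real.log s := by
    rw [hlog]; unfold agmLog; rw [← hm, ← hs]; ring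
  have l2 : Real.log 2 < 7 / 10 := Real.log_two_lt_d9.trans (by norm_num)
  have l20 : 0 < Real.log 2 := Real.log_pos one_lt_two
  have ls : Real.log (3 / 2 * s) ≤ (β + 7) / 2 * (7 / 10) := by
    have : 3 / 2 * s ≤ (2 : ℝ) ^ (c + 1) := by
      rw [zpow_add₀ two_ne_zero, zpow_one]; linarith
    have := Real.log_le_log (by positivity) this
    rw [Real.log_zpow] at this
    push_cast at this
    refine this.trans (mul_le_mul (by linarith) l2.le l20.le (by linarith))
  have ys : (4 / s) ^ 2 ≤ 8 * eps β := by
    rw [div_pow, div_le_iff₀ (by positivity)]; nlinarith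
  rw [hL]
  refine h.trans ?_
  have ls0 : 0 ≤ Real.log (3 / 2 * s) := Real.log_nonneg (by linarith)
  calc (4 / s) ^ 2 * (9 / 4 * Real.log (3 / 2 * s) + 2)
      ≤ 8 * eps β * (9 / 4 * ((β + 7) / 2 * (7 / 10)) + 2) := by
        have := eps_pos β
        gcongr
    _ ≤ 10 * β * eps β := by
        have := eps_pos β
        nlinarith

theorem tendsto_pow_mul_eps (j : ℕ) :
    Tendsto (fun β : ℕ => (β : ℝ) ^ j * eps β) atTop (nhds 0) := by
  have := tendsto_pow_const_mul_const_pow_of_abs_lt_one (r := (1 / 2 : ℝ)) j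
    (by rw [abs_of_pos] <;> norm_num)
  refine this.congr fun β => ?_
  simp [eps]

theorem tendsto_eps : Tendsto eps atTop (nhds 0) := by
  simpa using tendsto_pow_mul_eps 0

theorem IsRounding.abs_sub_le {β : ℕ} {rnd : ℝ → ℝ} (h : IsRounding β rnd) (x : ℝ) :
    |rnd x - x| ≤ eps β * |x| := by
  rcases eq_or_ne x 0 with rfl | hx
  · have := h.nearest 0 0 ⟨0, 0, by simp, by simp⟩
    simpa using this
  have hx' : 0 < |x| := abs_pos.2 hx
  set e := Int.log 2 |x| with he
  have h1 : (2 : ℝ) ^ e ≤ |x| := by exact_mod_cast Int.zpow_log_le_self (b := 2) (by norm_num) hx'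
  have h2 : |x| < (2 : ℝ) ^ (e + 1) := by
    exact_mod_cast Int.lt_zpow_succ_log_self (b := 2) (by norm_num) |x|
  set q : ℝ := (2 : ℝ) ^ (e + 1 - β) with hq
  have q0 : 0 < q := by positivity
  have q1 : q * 2 ^ β = 2 ^ (e + 1) := by
    rw [hq, zpow_sub₀ two_ne_zero, zpow_natCast]; field_simp
  have hr := abs_sub_round (x / q)
  have hb : |x / q| < 2 ^ β := by
    rw [abs_div, abs_of_pos q0, div_lt_iff₀ q0]; linarith
  -- Rounding to the grid of mesh q may reach the next power of two; the significand 2^β is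
  -- admitted, so the grid point is still a float.
  have hm : |round (x / q)| ≤ 2 ^ β := by
    have h3 : |(round (x / q) : ℝ)| < 2 ^ β + 1 := by
      have := abs_sub_abs_le_abs_sub (round (x / q) : ℝ) (x / q)
      rw [abs_sub_comm] at this
      linarith
    have h4 : |round (x / q)| < 2 ^ β + 1 := by exact_mod_cast h3
    omega
  refine (h.nearest x (round (x / q) * q) ⟨_, _, hm, rfl⟩).trans ?_
  have e1 : round (x / q) * q - x = -((x / q - round (x / q)) * q) := by field_simp; ring
  rw [e1, abs_neg, abs_mul, abs_of_pos q0]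
  have e2 : q = eps β * (2 * 2 ^ e) := by
    rw [zpow_add₀ two_ne_zero, zpow_one] at q1
    unfold eps
    field_simp
    linarith
  have := eps_pos β
  nlinarith

/-! ### Relative errors -/

/-- `x` approximates `X` with relative error at most `d`. -/
def RelErr (d x X : ℝ) : Prop := |x - X| ≤ d * |X|

theorem RelErr.mono {d d' x X : ℝ} (h : RelErr d x X) (hd : d ≤ d') : RelErr d' x X :=
  h.trans (by gcongr)

theorem RelErr.abs_le_mul {d x X : ℝ} (h : RelErr d x X) : |x| ≤ (1 + d) * |X| := by
  have := abs_sub_abs_le_abs_sub x X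
  unfold RelErr at h
  linarith

theorem RelErr.trans {d d' x y z : ℝ} (h : RelErr d x y) (h' : RelErr d' y z) (hd : 0 ≤ d) :
    RelErr (d + d' + d * d') x z := by
  have h1 := abs_sub_le x y z
  have h2 := mul_le_mul_of_nonneg_left h'.abs_le_mul hd
  unfold RelErr at *
  linarith

theorem RelErr.abs {d x X : ℝ} (h : RelErr d x X) : RelErr d |x| |X| := by
  unfold RelErr at *
  rw [abs_abs]
  exact (abs_abs_sub_abs_le x X).trans h

theorem RelErr.mul {d d' x X y Y : ℝ} (h : RelErr d x X) (h' : RelErr d' y Y) :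
    RelErr (d + d' + d * d') (x * y) (X * Y) := by
  have e : x * y - X * Y = (x - X) * (y - Y) + (x - X) * Y + X * (y - Y) := by ring
  unfold RelErr at *
  rw [e, abs_mul]
  refine (abs_add_three _ _ _).trans ?_
  rw [abs_mul, abs_mul, abs_mul]
  have h1 := mul_le_mul h h' (abs_nonneg _) ((abs_nonneg _).trans h)
  have h2 := mul_le_mul_of_nonneg_right h (abs_nonneg Y)
  have h3 := mul_le_mul_of_nonneg_left h' (abs_nonneg X)
  linarith

theorem RelErr.inv {d y Y : ℝ} (h : RelErr d y Y) (hd : d ≤ 1 / 2) (hY : Y ≠ 0) :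
    RelErr (2 * d) y⁻¹ Y⁻¹ := by
  have hY' := abs_pos.2 hY
  unfold RelErr at *
  have hy : |Y| / 2 ≤ |y| := by
    have := abs_sub_abs_le_abs_sub Y y
    rw [abs_sub_comm] at this
    nlinarith
  have hy0 : 0 < |y| := by linarith
  have e : y⁻¹ - Y⁻¹ = -(y - Y) * (y⁻¹ * Y⁻¹) := by
    have := abs_pos.1 hy0
    field_simp
    ring
  rw [e, abs_mul, abs_neg, abs_mul, abs_inv, abs_inv, ← mul_assoc]
  refine mul_le_mul_of_nonneg_right ?_ (by positivity)
  rw [← div_eq_mul_inv, div_le_iff₀ hy0]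
  have : 0 ≤ d := by
    have := (abs_nonneg _).trans h
    exact nonneg_of_mul_nonneg_left this hY'
  nlinarith

/-- √x − √X = (x − X)/(√x + √X), and the denominator is at least √X, so the error does not grow. The
bound d ≤ 1 keeps x nonnegative. -/
theorem RelErr.sqrt {d x X : ℝ} (h : RelErr d x X) (hd : d ≤ 1) (hX : 0 ≤ X) :
    RelErr d √x √X := by
  unfold RelErr at *
  rw [abs_of_nonneg hX] at h
  rw [abs_of_nonneg (Real.sqrt_nonneg X)]
  rcases hX.eq_or_lt with rfl | hX
  · simp only [sub_zero, mul_zero, abs_nonpos_iff] at h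
    simp [h]
  have hx : 0 ≤ x := by
    have := (abs_le.1 h).1
    nlinarith
  have s0 := Real.sqrt_pos.2 hX
  have e : x - X = (√x - √X) * (√x + √X) := by
    have h1 := Real.sq_sqrt hx
    have h2 := Real.sq_sqrt hX.le
    linear_combination h2 - h1
  have h3 : X = √X * √X := (Real.mul_self_sqrt hX.le).symm
  have h4 : |√x - √X| * √X ≤ d * √X * √X := by
    calc |√x - √X| * √X ≤ |√x - √X| * (√x + √X) := by
          gcongr; linarith [Real.sqrt_nonneg x]
      _ = |x - X| := by rw [e, abs_mul, abs_of_nonneg (by positivity : 0 ≤ √x + √X)]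
      _ ≤ d * √X * √X := by rw [mul_assoc, ← h3]; exact h
  exact le_of_mul_le_mul_right h4 s0

theorem RelErr.add {d x X y Y K : ℝ} (h : RelErr d x X) (h' : RelErr d y Y) (hd : 0 ≤ d)
    (hK : |X| + |Y| ≤ K * |X + Y|) : RelErr (d * |K|) (x + y) (X + Y) := by
  unfold RelErr at *
  have e : x + y - (X + Y) = (x - X) + (y - Y) := by ring
  rw [e]
  refine (abs_add_le _ _).trans ((add_le_add h h').trans ?_)
  rw [← mul_add, mul_assoc]
  gcongr
  exact hK.trans (by gcongr; exact le_abs_self K)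

theorem RelErr.neg {d x X : ℝ} (h : RelErr d x X) : RelErr d (-x) (-X) := by
  unfold RelErr at *
  rwa [abs_neg, ← neg_sub', abs_neg]

theorem RelErr.rnd {β : ℕ} {rnd : ℝ → ℝ} (hr : IsRounding β rnd) {C x X : ℝ} (hC : 0 ≤ C)
    (h : RelErr (C * eps β) x X) (he : eps β ≤ 1) : RelErr ((2 * C + 1) * eps β) (rnd x) X := by
  have e0 := eps_pos β
  have h1 : RelErr (eps β) (rnd x) x := hr.abs_sub_le x
  refine (h1.trans h e0.le).mono ?_
  have : eps β * (C * eps β) ≤ 1 * (C * eps β) := by gcongr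
  linarith

/-- For a fixed expression, well-conditioned floating-point evaluation has a relative error
of `O(ε)`. -/
theorem HatExpr.exists_relErr_fleval (K : ℝ) (E : HatExpr) :
    ∃ C : ℝ, 0 ≤ C ∧ ∀ᶠ β : ℕ in atTop, ∀ rnd : ℝ → ℝ, IsRounding β rnd →
      ∀ (N : ℕ) (P U : ℝ), E.WellConditioned K N P U →
        RelErr (C * eps β) (E.fleval rnd N P U) (E.eval N P U) := by
  -- Inversion needs a relative error of at most 1/2, and the square root one of at most 1; this
  -- decides how large β must be.
  have small : ∀ C : ℝ, ∀ᶠ β : ℕ in atTop, C * eps β ≤ 1 / 2 := fun C => by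
    have : Tendsto (fun β => C * eps β) atTop (nhds 0) := by simpa using tendsto_eps.const_mul C
    exact this.eventually_le_const (by norm_num)
  have he : ∀ᶠ β : ℕ in atTop, eps β ≤ 1 := tendsto_eps.eventually_le_const one_pos
  have leaf : ∀ (β : ℕ) (rnd : ℝ → ℝ), IsRounding β rnd → ∀ x, RelErr (1 * eps β) (rnd x) x :=
    fun β rnd hr x => by rw [one_mul]; exact hr.abs_sub_le x
  have addcase : ∀ a b : ℝ, 0 ≤ a → 0 ≤ b → ∀ β : ℕ, eps β ≤ 1 → ∀ rnd, IsRounding β rnd →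
      ∀ x X y Y, RelErr (a * eps β) x X → RelErr (b * eps β) y Y →
      |X| + |Y| ≤ K * |X + Y| →
      RelErr ((2 * ((2 * (a + b) + 1) * |K|) + 1) * eps β) (rnd (rnd x + rnd y)) (X + Y) := by
    intro a b ha hb β hβ rnd hr x X y Y hx hy hK
    have e0 := eps_pos β
    have h1 := (hx.mono (d' := (a + b) * eps β) (by nlinarith)).rnd hr (by positivity) hβ
    have h2 := (hy.mono (d' := (a + b) * eps β) (by nlinarith)).rnd hr (by positivity) hβ
    refine RelErr.rnd hr (by positivity) ?_ hβ
    exact (h1.add h2 (by positivity) hK).mono (by linarith)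
  have mulcase : ∀ a b : ℝ, 0 ≤ a → 0 ≤ b → ∀ β : ℕ, eps β ≤ 1 → ∀ rnd, IsRounding β rnd →
      ∀ x X y Y, RelErr (a * eps β) x X → RelErr (b * eps β) y Y →
      RelErr ((2 * (a + b + a * b) + 1) * eps β) (rnd (x * y)) (X * Y) := by
    intro a b ha hb β hβ rnd hr x X y Y hx hy
    have e0 := eps_pos β
    refine RelErr.rnd hr (by positivity) ?_ hβ
    refine (hx.mul hy).mono ?_
    have : a * b * eps β * eps β ≤ a * b * eps β * 1 := by gcongr
    linarith
  induction E with
  | const r => exact ⟨1, zero_le_one, .of_forall fun β rnd hr N P U _ => leaf β rnd hr _⟩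
  | n => exact ⟨1, zero_le_one, .of_forall fun β rnd hr N P U _ => leaf β rnd hr _⟩
  | p => exact ⟨1, zero_le_one, .of_forall fun β rnd hr N P U _ => leaf β rnd hr _⟩
  | u => exact ⟨1, zero_le_one, .of_forall fun β rnd hr N P U _ => leaf β rnd hr _⟩
  | abs a ih =>
    obtain ⟨C, hC, h⟩ := ih
    exact ⟨C, hC, h.mono fun β h rnd hr N P U hw => (h rnd hr N P U hw).abs⟩
  | add a b iha ihb =>
    obtain ⟨A, hA, ha⟩ := iha
    obtain ⟨B, hB, hb⟩ := ihb
    refine ⟨2 * ((2 * (A + B) + 1) * |K|) + 1, by positivity, ?_⟩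
    filter_upwards [ha, hb, he] with β ha hb he rnd hr N P U hw
    exact addcase A B hA hB β he rnd hr _ _ _ _ (ha rnd hr N P U hw.1) (hb rnd hr N P U hw.2.1)
      hw.2.2
  | sub a b iha ihb =>
    obtain ⟨A, hA, ha⟩ := iha
    obtain ⟨B, hB, hb⟩ := ihb
    refine ⟨2 * ((2 * (A + B) + 1) * |K|) + 1, by positivity, ?_⟩
    filter_upwards [ha, hb, he] with β ha hb he rnd hr N P U hw
    have e0 := eps_pos β
    have h1 := ((ha rnd hr N P U hw.1).mono (d' := (A + B) * eps β)
      (by nlinarith)).rnd hr (by positivity) he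
    have h2 := ((hb rnd hr N P U hw.2.1).mono (d' := (A + B) * eps β)
      (by nlinarith)).rnd hr (by positivity) he
    refine RelErr.rnd hr (by positivity) ?_ he
    have := (h1.add h2.neg (by positivity) (K := K) (by
      rw [abs_neg, ← sub_eq_add_neg]; exact hw.2.2)).mono
        (d' := (2 * (A + B) + 1) * |K| * eps β) (by linarith)
    rwa [← sub_eq_add_neg, ← sub_eq_add_neg] at this
  | mul a b iha ihb =>
    obtain ⟨A, hA, ha⟩ := iha
    obtain ⟨B, hB, hb⟩ := ihb
    refine ⟨2 * ((2 * A + 1) + (2 * B + 1) + (2 * A + 1) * (2 * B + 1)) + 1, by positivity, ?_⟩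
    filter_upwards [ha, hb, he] with β ha hb he rnd hr N P U hw
    exact mulcase (2 * A + 1) (2 * B + 1) (by positivity) (by positivity) β he rnd hr _ _ _ _
      ((ha rnd hr N P U hw.1).rnd hr hA he) ((hb rnd hr N P U hw.2).rnd hr hB he)
  | div a b iha ihb =>
    obtain ⟨A, hA, ha⟩ := iha
    obtain ⟨B, hB, hb⟩ := ihb
    refine ⟨2 * ((2 * A + 1) + 2 * (2 * B + 1) + (2 * A + 1) * (2 * (2 * B + 1))) + 1,
      by positivity, ?_⟩
    filter_upwards [ha, hb, he, small (2 * B + 1)] with β ha hb he hs rnd hr N P U hw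
    have h1 := (ha rnd hr N P U hw.1).rnd hr hA he
    have h2 := (((hb rnd hr N P U hw.2.1).rnd hr hB he).inv hs hw.2.2).mono
      (d' := 2 * (2 * B + 1) * eps β) (by linarith)
    have := mulcase _ _ (by positivity) (by positivity) β he rnd hr _ _ _ _ h1 h2
    rwa [← div_eq_mul_inv, ← div_eq_mul_inv] at this
  | sqrt a ih =>
    obtain ⟨A, hA, ha⟩ := ih
    refine ⟨2 * (2 * A + 1) + 1, by positivity, ?_⟩
    filter_upwards [ha, he, small (2 * A + 1)] with β ha he hs rnd hr N P U hw
    exact (((ha rnd hr N P U hw.1).rnd hr hA he).sqrt (by linarith) hw.2).rnd hr (by positivity) he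

/-! ### The size of the Lanczos series -/

/-- A nonconstant polynomial has absolute value at least 1 at all large integers, which leaves
finitely many k. Zeros are harmless because `Real.log 0 = 0`. -/
theorem exists_neg_log_abs_eval_le (P : Polynomial ℝ) :
    ∃ C : ℝ, ∀ k : ℕ, -Real.log |P.eval (k : ℝ)| ≤ C := by
  have h : IsBoundedUnder (· ≤ ·) atTop fun k : ℕ => -Real.log |P.eval (k : ℝ)| := by
    rcases le_or_gt P.degree 0 with hP | hP
    · rw [Polynomial.eq_C_of_degree_le_zero hP]
      simp only [Polynomial.eval_C]
      exact isBoundedUnder_const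
    · refine isBoundedUnder_of_eventually_le (a := 0) ?_
      have := (Polynomial.tendsto_abv_atTop abs P hP (z := fun k : ℕ => (k : ℝ))
        (tendsto_abs_atTop_atTop.comp tendsto_natCast_atTop_atTop)).eventually_ge_atTop 1
      filter_upwards [this] with k hk
      have := Real.log_nonneg hk
      linarith
  obtain ⟨C, hC⟩ := h.bddAbove_range
  exact ⟨C, fun k => hC ⟨k, rfl⟩⟩

/-- Each factor (k − i)/(k + i + 1) has absolute value at most 1, which bounds the series above.
Clearing denominators gives a polynomial in k, so the series can be small only through its
denominator. -/
theorem exists_abs_log_lanczosA_le (t : ℕ) (g : ℝ) :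
    ∃ C : ℝ, ∀ k : ℕ, 0 < lanczosA t g k → |Real.log (lanczosA t g k)| ≤ k + C := by
  set c : ℕ → ℝ := fun j => (if j = 0 then 1 / 2 else 1) * lanczosCoeff g j with hc
  let P : Polynomial ℝ := ∑ j ∈ Finset.range t, Polynomial.C (c j)
    * (∏ i ∈ Finset.range j, (Polynomial.X - Polynomial.C (i : ℝ)))
    * ∏ i ∈ Finset.Ico j t, (Polynomial.X + Polynomial.C ((i : ℝ) + 1))
  obtain ⟨C, hC⟩ := exists_neg_log_abs_eval_le P
  have hD : ∀ k : ℕ, 0 < ∏ i ∈ Finset.range t, ((k : ℝ) + i + 1) := fun k =>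
    Finset.prod_pos fun i _ => by positivity
  have hP : ∀ k : ℕ, P.eval (k : ℝ)
      = lanczosA t g k * ∏ i ∈ Finset.range t, ((k : ℝ) + i + 1) := fun k => by
    simp only [P, Polynomial.eval_finsetSum, Polynomial.eval_mul, Polynomial.eval_prod,
      Polynomial.eval_C, Polynomial.eval_sub, Polynomial.eval_add, Polynomial.eval_X]
    rw [lanczosA, Finset.sum_mul]
    refine Finset.sum_congr rfl fun j hj => ?_
    rw [← Finset.prod_range_mul_prod_Ico (fun i : ℕ => (k : ℝ) + i + 1) (Finset.mem_range.1 hj).le,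
      Finset.prod_div_distrib]
    have : ∏ i ∈ Finset.range j, ((k : ℝ) + i + 1) ≠ 0 :=
      (Finset.prod_pos fun i _ => by positivity).ne'
    simp only [hc, add_assoc] at this ⊢
    field_simp
  have hup : ∀ k : ℕ, lanczosA t g k ≤ ∑ j ∈ Finset.range t, |c j| := fun k => by
    refine Finset.sum_le_sum fun j _ => ?_
    refine (le_abs_self _).trans ?_
    rw [abs_mul]
    refine mul_le_of_le_one_right (abs_nonneg _) ?_
    rw [Finset.abs_prod]
    refine Finset.prod_le_one (fun i _ => abs_nonneg _) fun i _ => ?_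
    have : (0 : ℝ) < k + i + 1 := by positivity
    rw [abs_div, abs_of_pos this, div_le_one this, abs_le]
    constructor <;> linarith [Nat.cast_nonneg (α := ℝ) k, Nat.cast_nonneg (α := ℝ) i]
  have hlog : ∀ k : ℕ, Real.log (∏ i ∈ Finset.range t, ((k : ℝ) + i + 1))
      ≤ k + t * (1 + Real.log (t + 1)) := fun k => by
    rw [Real.log_prod fun i _ => by positivity]
    -- The tangent of the logarithm at t + 1 is used so that the t slopes 1/(t + 1) add up to less
    -- than 1.
    have : ∀ i ∈ Finset.range t, Real.log ((k : ℝ) + i + 1)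
        ≤ k / (t + 1) + (1 + Real.log (t + 1)) := fun i hi => by
      have hit : (i : ℝ) + 1 ≤ t := by exact_mod_cast Finset.mem_range.1 hi
      have ht : (0 : ℝ) < t + 1 := by positivity
      have h1 := Real.log_le_sub_one_of_pos (show 0 < ((k : ℝ) + i + 1) / (t + 1) by positivity)
      rw [Real.log_div (by positivity) ht.ne'] at h1
      have h2 : ((k : ℝ) + i + 1) / (t + 1) ≤ k / (t + 1) + 1 := by
        rw [div_add_one ht.ne']
        exact div_le_div_of_nonneg_right (by linarith) ht.le
      linarith
    refine (Finset.sum_le_sum this).trans ?_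
    rw [Finset.sum_const, Finset.card_range, nsmul_eq_mul, mul_add]
    gcongr
    rw [mul_div_assoc', div_le_iff₀ (by positivity)]
    nlinarith [Nat.cast_nonneg (α := ℝ) k]
  refine ⟨max (Real.log (∑ j ∈ Finset.range t, |c j|)) (C + t * (1 + Real.log (t + 1))),
    fun k hk => abs_le.2 ⟨?_, ?_⟩⟩
  · have h1 := hC k
    rw [hP, abs_of_pos (mul_pos hk (hD k)), Real.log_mul hk.ne' (hD k).ne'] at h1
    have h2 := hlog k
    have h3 := le_max_right (Real.log (∑ j ∈ Finset.range t, |c j|))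
      (C + t * (1 + Real.log (t + 1)))
    linarith
  · have h1 := Real.log_le_log hk (hup k)
    have h3 := le_max_left (Real.log (∑ j ∈ Finset.range t, |c j|))
      (C + t * (1 + Real.log (t + 1)))
    linarith [Nat.cast_nonneg (α := ℝ) k]

/-! ### Absolute errors on the scale nβε -/

theorem RelErr.abs_log_sub_log_le {d x X : ℝ} (h : RelErr d x X) (hd : d ≤ 1 / 2) (hX : 0 < X) :
    0 < x ∧ |Real.log x - Real.log X| ≤ 2 * d := by
  unfold RelErr at h
  rw [abs_of_pos hX, abs_le] at h
  have hx : X / 2 ≤ x := by nlinarith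
  have hx0 : 0 < x := by linarith
  refine ⟨hx0, ?_⟩
  have hd0 : 0 ≤ d := by nlinarith
  have h1 := Real.log_le_sub_one_of_pos (div_pos hx0 hX)
  have h2 := Real.log_le_sub_one_of_pos (div_pos hX hx0)
  rw [Real.log_div hx0.ne' hX.ne'] at h1
  rw [Real.log_div hX.ne' hx0.ne'] at h2
  have h3 : x / X ≤ 1 + d := by rw [div_le_iff₀ hX]; linarith
  have h4 : X / x ≤ 1 + 2 * d := by rw [div_le_iff₀ hx0]; nlinarith
  rw [abs_le]
  constructor <;> linarith

/-- `x` approximates `X` up to `e · M · ε`, and `X` has size at most `m · M`. -/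
structure Approx (M ε m e x X : ℝ) : Prop where
  err : |x - X| ≤ e * (M * ε)
  size : |X| ≤ m * M

theorem Approx.neg {M ε m e x X : ℝ} (h : Approx M ε m e x X) : Approx M ε m e (-x) (-X) :=
  ⟨by rw [← neg_sub', abs_neg]; exact h.err, by rw [abs_neg]; exact h.size⟩

/-- A rounding costs ε|x|, and |x| ≤ (m + 1)M once the accumulated error is at most M. -/
theorem Approx.rnd {β : ℕ} {rnd : ℝ → ℝ} (hr : IsRounding β rnd) {M m e x X : ℝ} (hM : 0 ≤ M)
    (h : Approx M (eps β) m e x X) (he : e * eps β ≤ 1) :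
    Approx M (eps β) m (e + m + 1) (rnd x) X := by
  refine ⟨?_, h.size⟩
  have e0 := eps_pos β
  have h1 := abs_sub_le (rnd x) x X
  have h2 := hr.abs_sub_le x
  have h3 := abs_sub_abs_le_abs_sub x X
  have h4 : |x| ≤ (m + 1) * M := by
    have := mul_le_mul_of_nonneg_right he hM
    linarith [h.err, h.size]
  have h5 := mul_le_mul_of_nonneg_left h4 e0.le
  linarith [h.err]

theorem Approx.add {M ε m e x X m' e' y Y : ℝ} (h : Approx M ε m e x X)
    (h' : Approx M ε m' e' y Y) : Approx M ε (m + m') (e + e') (x + y) (X + Y) := by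
  constructor
  · rw [add_sub_add_comm]
    refine (abs_add_le _ _).trans ?_
    linarith [h.err, h'.err]
  · refine (abs_add_le _ _).trans ?_
    linarith [h.size, h'.size]

theorem Approx.fadd {β : ℕ} {rnd : ℝ → ℝ} (hr : IsRounding β rnd) {M m e x X m' e' y Y : ℝ}
    (hM : 0 ≤ M) (h : Approx M (eps β) m e x X) (h' : Approx M (eps β) m' e' y Y)
    (he : e * eps β ≤ 1) (he' : e' * eps β ≤ 1)
    (hs : (e + m + 1 + (e' + m' + 1)) * eps β ≤ 1) :
    Approx M (eps β) (m + m') (e + m + 1 + (e' + m' + 1) + (m + m') + 1)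
      (fadd rnd x y) (X + Y) :=
  ((h.rnd hr hM he).add (h'.rnd hr hM he')).rnd hr hM hs

theorem Approx.fsub {β : ℕ} {rnd : ℝ → ℝ} (hr : IsRounding β rnd) {M m e x X m' e' y Y : ℝ}
    (hM : 0 ≤ M) (h : Approx M (eps β) m e x X) (h' : Approx M (eps β) m' e' y Y)
    (he : e * eps β ≤ 1) (he' : e' * eps β ≤ 1)
    (hs : (e + m + 1 + (e' + m' + 1)) * eps β ≤ 1) :
    Approx M (eps β) (m + m') (e + m + 1 + (e' + m' + 1) + (m + m') + 1)
      (fsub rnd x y) (X - Y) := by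
  have := ((h.rnd hr hM he).add (h'.rnd hr hM he').neg).rnd hr hM hs
  rwa [← sub_eq_add_neg, ← sub_eq_add_neg] at this

theorem approx_fmul_log {β : ℕ} {rnd : ℝ → ℝ} (hr : IsRounding β rnd) (hβ : 20 ≤ β)
    (he : eps β ≤ 1 / 20) {n j : ℕ} (hj : j ≤ n) {p : ℝ} (hp : 0 < p)
    (hl : |Real.log p| ≤ β) :
    Approx (n * β) (eps β) 1 18 (fmul rnd j (agmLog β p)) (j * Real.log p) := by
  have e0 := eps_pos β
  have hj' : (j : ℝ) ≤ n := by exact_mod_cast hj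
  have hj0 : (0 : ℝ) ≤ j := j.cast_nonneg
  have hβ0 : (0 : ℝ) ≤ β := β.cast_nonneg
  have size : |j * Real.log p| ≤ 1 * (n * β) := by
    rw [abs_mul, abs_of_nonneg hj0, one_mul]
    gcongr
  refine ⟨?_, size⟩
  have hL := abs_agmLog_sub_log_le hβ hp
  have a1 := hr.abs_sub_le (j : ℝ)
  rw [abs_of_nonneg hj0] at a1
  have a1' : |rnd j - j| ≤ eps β * n := a1.trans (by gcongr)
  have a2 := hr.abs_sub_le (agmLog β p)
  have bL : |agmLog β p| ≤ 2 * β := by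
    have := abs_sub_abs_le_abs_sub (agmLog β p) (Real.log p)
    nlinarith
  have a3 : |rnd (agmLog β p) - Real.log p| ≤ 12 * β * eps β := by
    have := abs_sub_le (rnd (agmLog β p)) (agmLog β p) (Real.log p)
    nlinarith
  have bL' : |rnd (agmLog β p)| ≤ 2 * β := by
    have := abs_sub_abs_le_abs_sub (rnd (agmLog β p)) (Real.log p)
    nlinarith
  set k' := rnd j
  set l' := rnd (agmLog β p)
  have a4 : |k' * l' - j * Real.log p| ≤ 14 * (n * β * eps β) := by
    have e : k' * l' - j * Real.log p = (k' - j) * l' + j * (l' - Real.log p) := by ring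
    rw [e]
    refine (abs_add_le _ _).trans ?_
    rw [abs_mul, abs_mul, abs_of_nonneg hj0]
    have b1 := mul_le_mul a1' bL' (abs_nonneg _) (by positivity)
    have b2 := mul_le_mul hj' a3 (abs_nonneg _) (by positivity)
    linarith
  have a5 : |k' * l'| ≤ 2 * (n * β) := by
    have := abs_sub_abs_le_abs_sub (k' * l') (j * Real.log p)
    have : n * β * eps β ≤ n * β * (1 / 20) := by gcongr
    have : (0 : ℝ) ≤ n * β := by positivity
    linarith
  have a6 := hr.abs_sub_le (k' * l')
  have a7 := abs_sub_le (rnd (k' * l')) (k' * l') (j * Real.log p)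
  have a8 : eps β * |k' * l'| ≤ eps β * (2 * (n * β)) := by gcongr
  have a9 : 0 ≤ n * β * eps β := by positivity
  unfold fmul
  linarith

/-! ### Lanczos factorials and the logarithm of the ratio -/

theorem factLancz_pos {t : ℕ} {g : ℝ} (hg : 0 < g + 1 / 2) {j : ℕ} (hA : 0 < lanczosA t g j) :
    0 < factLancz t g j := by
  have : (0 : ℝ) < j + g + 1 / 2 := by linarith [j.cast_nonneg (α := ℝ)]
  have := Real.pi_pos
  unfold factLancz
  positivity

theorem log_factLancz {t : ℕ} {g : ℝ} (hg : 0 < g + 1 / 2) {j : ℕ} (hA : 0 < lanczosA t g j) :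
    Real.log (factLancz t g j) = 1 / 2 * Real.log (2 * Real.pi)
      + ((j : ℝ) + 1 / 2) * Real.log ((j : ℝ) + g + 1 / 2) - ((j : ℝ) + g + 1 / 2)
      + Real.log (lanczosA t g j) := by
  have : (0 : ℝ) < j + g + 1 / 2 := by linarith [j.cast_nonneg (α := ℝ)]
  have := Real.pi_pos
  unfold factLancz
  rw [Real.log_mul (by positivity) hA.ne', Real.log_mul (by positivity) (by positivity),
    Real.log_mul (by positivity) (by positivity), Real.log_exp, Real.log_rpow (by positivity),
    Real.log_sqrt (by positivity)]
  ring

/-- Only the three computed logarithms are inexact here; their weights 1/2, j + 1/2 and 1 sum to j +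
2 ≤ 3n, whence 30 = 3 · 10. -/
theorem eventually_approx_logFactorial (t : ℕ) {g : ℝ} (hg : 0 < g + 1 / 2) :
    ∀ᶠ β : ℕ in atTop, ∀ n : ℕ, 1 ≤ n → Real.log n ≤ β / 2 * (7 / 10) → ∀ j ≤ n,
      0 < lanczosA t g j → Approx (n * β) (eps β) 4 30 (logFactorial β t g j)
        (Real.log (factLancz t g j)) := by
  obtain ⟨C, hC⟩ := exists_abs_log_lanczosA_le t g
  set c := g + 1 / 2 with hc
  have hβC : ∀ C : ℝ, ∀ᶠ β : ℕ in atTop, C ≤ β := fun C =>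
    tendsto_natCast_atTop_atTop.eventually_ge_atTop C
  filter_upwards [eventually_ge_atTop 20, hβC (7 * (Real.log (1 + c) + |Real.log c|)),
    hβC (c + C + 2)] with β hβ h1 h2 n hn hl j hj hA
  have hn' : (1 : ℝ) ≤ n := by exact_mod_cast hn
  have hj' : (j : ℝ) ≤ n := by exact_mod_cast hj
  have hj0 : (0 : ℝ) ≤ j := j.cast_nonneg
  have hβ' : (20 : ℝ) ≤ β := by exact_mod_cast hβ
  have e0 := eps_pos β
  have hjc : (j : ℝ) + g + 1 / 2 = j + c := by rw [hc]; ring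
  have l2π : |Real.log (2 * Real.pi)| ≤ 4 := by
    have p1 := Real.pi_gt_three
    have p2 := Real.pi_lt_d2
    have b1 := Real.log_nonneg (show 1 ≤ 2 * Real.pi by linarith)
    have b2 := Real.log_le_sub_one_of_pos (show 0 < 2 * Real.pi / 4 by positivity)
    rw [Real.log_div (by positivity) (by norm_num)] at b2
    have b3 : Real.log 4 ≤ 2 := by
      have : Real.log 4 = 2 * Real.log 2 := by
        rw [show (4 : ℝ) = 2 ^ 2 by norm_num, Real.log_pow]; norm_num
      linarith [Real.log_two_lt_d9]
    rw [abs_of_nonneg b1]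
    linarith
  -- log n ≤ 0.35β and the terms in c are at most β/7, which together stay below β/2.
  have ljc : |Real.log (j + c)| ≤ β / 2 := by
    have u := Real.log_le_log (show 0 < j + c by positivity) (show j + c ≤ n * (1 + c) by nlinarith)
    rw [Real.log_mul (by positivity) (by positivity)] at u
    have l := Real.log_le_log hg (show c ≤ j + c by linarith)
    have := neg_abs_le (Real.log c)
    have := Real.log_nonneg hn'
    have := Real.log_nonneg (show 1 ≤ 1 + c by linarith)
    have := abs_nonneg (Real.log c)
    rw [abs_le]
    constructor <;> linarith
  have hM : (n : ℝ) * 20 ≤ n * β := by gcongr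
  have hM' : (β : ℝ) ≤ n * β := by nlinarith
  rw [log_factLancz hg hA, hjc, logFactorial, hjc]
  constructor
  · have a1 := abs_agmLog_sub_log_le hβ (show 0 < 2 * Real.pi by positivity)
    have a2 := abs_agmLog_sub_log_le hβ (show 0 < j + c by positivity)
    have a3 := abs_agmLog_sub_log_le hβ hA
    have e : 1 / 2 * agmLog β (2 * Real.pi) + ((j : ℝ) + 1 / 2) * agmLog β (j + c) - (j + c)
        + agmLog β (lanczosA t g j) - (1 / 2 * Real.log (2 * Real.pi)
        + ((j : ℝ) + 1 / 2) * Real.log (j + c) - (j + c) + Real.log (lanczosA t g j))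
        = 1 / 2 * (agmLog β (2 * Real.pi) - Real.log (2 * Real.pi))
        + ((j : ℝ) + 1 / 2) * (agmLog β (j + c) - Real.log (j + c))
        + (agmLog β (lanczosA t g j) - Real.log (lanczosA t g j)) := by ring
    rw [e]
    refine (abs_add_three _ _ _).trans ?_
    rw [abs_mul, abs_mul, abs_of_nonneg (show (0 : ℝ) ≤ 1 / 2 by norm_num),
      abs_of_nonneg (show (0 : ℝ) ≤ j + 1 / 2 by positivity)]
    have b2 := mul_le_mul_of_nonneg_left a2 (show (0 : ℝ) ≤ j + 1 / 2 by positivity)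
    have b4 : (j + 2) * (10 * β * eps β) ≤ (3 * n) * (10 * β * eps β) := by gcongr; linarith
    linarith
  · have b1 := abs_le.1 l2π
    have b2 : |((j : ℝ) + 1 / 2) * Real.log (j + c)| ≤ (3 / 2 * n) * (β / 2) := by
      rw [abs_mul, abs_of_nonneg (show (0 : ℝ) ≤ j + 1 / 2 by positivity)]
      exact mul_le_mul (by linarith) ljc (abs_nonneg _) (by positivity)
    have b3 := abs_le.1 b2
    have b4 := abs_le.1 (hC j hA)
    have c0 : 0 < c := hg
    rw [abs_le]
    constructor <;> linarith

theorem log_ratioInter {t : ℕ} {g : ℝ} (hg : 0 < g + 1 / 2) {n k : ℕ} {p α : ℝ} {h : ℕ → ℝ}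
    (hp : 0 < p) (hp1 : p < 1) (hk : k ≤ n) (hA : ∀ j ≤ n, 0 < lanczosA t g j) (hα : 0 < α)
    (hh : 0 < h k) :
    0 < ratioInter t g n p α h k ∧ Real.log (ratioInter t g n p α h k)
      = Real.log (factLancz t g n) - Real.log (factLancz t g k)
        - Real.log (factLancz t g (n - k)) + k * Real.log p
        + ((n - k : ℕ) : ℝ) * Real.log (1 - p) + Real.log (1 / h k) - Real.log α := by
  have h1 := factLancz_pos hg (hA n le_rfl)
  have h2 := factLancz_pos hg (hA k hk)
  have h3 := factLancz_pos hg (hA (n - k) (Nat.sub_le n k))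
  have hq : 0 < 1 - p := by linarith
  unfold ratioInter binomInter
  refine ⟨by positivity, ?_⟩
  rw [Real.log_div (by positivity) (by positivity), Real.log_mul (by positivity) (by positivity),
    Real.log_mul (by positivity) (by positivity), Real.log_div (by positivity) (by positivity),
    Real.log_mul (by positivity) (by positivity), Real.log_mul (by positivity) (by positivity),
    Real.log_pow, Real.log_pow, one_div, Real.log_inv]
  ring

theorem neg_log_binom_le {n k : ℕ} (hk : k ≤ n) {p b : ℝ} (hp : 0 < p) (hp1 : p < 1)
    (hl : -Real.log p ≤ b) (hl' : -Real.log (1 - p) ≤ b) :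
    0 < binom n p k ∧ -Real.log (binom n p k) ≤ n * b := by
  have hq : 0 < 1 - p := by linarith
  have hc : (1 : ℝ) ≤ n.choose k := by exact_mod_cast Nat.choose_pos hk
  have hc0 : (0 : ℝ) < n.choose k := by linarith
  unfold binom
  refine ⟨by positivity, ?_⟩
  rw [Real.log_mul (by positivity) (by positivity), Real.log_mul (by positivity) (by positivity),
    Real.log_pow, Real.log_pow]
  have h1 := Real.log_nonneg hc
  have h2 := mul_le_mul_of_nonneg_left hl (k.cast_nonneg (α := ℝ))
  have h3 := mul_le_mul_of_nonneg_left hl' ((n - k).cast_nonneg (α := ℝ))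
  have h4 : (n : ℝ) = k + (n - k : ℕ) := by exact_mod_cast (Nat.add_sub_cancel' hk).symm
  have h5 : (n : ℝ) * b = k * b + (n - k : ℕ) * b := by rw [← add_mul, ← h4]
  linarith

theorem neg_log_le_of_ceil_logb_le {β : ℕ} {p : ℝ} (h : ⌈-Real.logb 2 p⌉ ≤ (β : ℤ)) :
    -Real.log p ≤ β := by
  have h1 : -Real.logb 2 p ≤ β := by exact_mod_cast Int.ceil_le.1 h
  have l2 : 0 < Real.log 2 := Real.log_pos one_lt_two
  rw [Real.logb, ← neg_div, div_le_iff₀ l2] at h1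
  have := Real.log_two_lt_d9
  nlinarith [β.cast_nonneg (α := ℝ)]

theorem sq_le_and_log_le_of_ceil_logb_le {β n : ℕ} (hn : 1 ≤ n)
    (h : 2 * ⌈Real.logb 2 n⌉ ≤ (β : ℤ)) :
    (n : ℝ) ^ 2 * eps β ≤ 1 ∧ Real.log n ≤ β / 2 * (7 / 10) := by
  have hn0 : (0 : ℝ) < n := by exact_mod_cast hn
  have h1 : 2 * (⌈Real.logb 2 n⌉ : ℝ) ≤ β := by exact_mod_cast h
  have h2 := Int.le_ceil (Real.logb 2 n)
  have l2 : 0 < Real.log 2 := Real.log_pos one_lt_two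
  have h3 : Real.logb 2 n ≤ β / 2 := by linarith
  rw [Real.logb, div_le_iff₀ l2] at h3
  constructor
  · unfold eps
    rw [mul_one_div, div_le_one (by positivity), ← Real.log_le_log_iff (by positivity) (by positivity),
      Real.log_pow, Real.log_pow]
    push_cast
    linarith
  · refine h3.trans ?_
    have := Real.log_two_lt_d9
    gcongr
    linarith

theorem approx_logRatio {β : ℕ} {rnd : ℝ → ℝ} (hr : IsRounding β rnd) (hβ : 20 ≤ β)
    (he : 1000 * eps β ≤ 1) {t : ℕ} {g : ℝ} {n k : ℕ} (hk : k ≤ n) (hn : 1 ≤ n) {p α x X : ℝ}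
    (hL : ∀ j ≤ n, Approx (n * β) (eps β) 4 30 (logFactorial β t g j)
      (Real.log (factLancz t g j)))
    (hp : 0 < p) (hp1 : p < 1) (hl : -Real.log p ≤ β) (hl' : -Real.log (1 - p) ≤ β)
    (hx : 0 < x) (hxX : |Real.log x - Real.log X| ≤ β * eps β)
    (hX : |Real.log X| ≤ 2 * (n * β))
    (hα : 0 < α) (hα' : |Real.log α| ≤ n * β) :
    |logRatio rnd β t g n p α x k - (Real.log (factLancz t g n) - Real.log (factLancz t g k)
        - Real.log (factLancz t g (n - k)) + k * Real.log p
        + ((n - k : ℕ) : ℝ) * Real.log (1 - p) + Real.log X - Real.log α)|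
      ≤ 331 * (n * β * eps β) := by
  have e0 := eps_pos β
  have hM : (0 : ℝ) ≤ n * β := by positivity
  have hn' : (1 : ℝ) ≤ n := by exact_mod_cast hn
  have hM' : β * eps β ≤ n * β * eps β := by
    have : 0 ≤ β * eps β := by positivity
    nlinarith
  have hq : 0 < 1 - p := by linarith
  have al : |Real.log p| ≤ β := by
    rwa [abs_of_nonpos (Real.log_nonpos hp.le hp1.le)]
  have al' : |Real.log (1 - p)| ≤ β := by
    rwa [abs_of_nonpos (Real.log_nonpos hq.le (by linarith))]
  have a4 := approx_fmul_log hr hβ (by linarith) hk hp al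
  have a5 := approx_fmul_log hr hβ (by linarith) (Nat.sub_le n k) hq al'
  have a6 : Approx (n * β) (eps β) 2 11 (agmLog β x) (Real.log X) := by
    refine ⟨(abs_sub_le _ (Real.log x) _).trans ?_, hX⟩
    have := abs_agmLog_sub_log_le hβ hx
    linarith
  have a7 : Approx (n * β) (eps β) 1 10 (agmLog β α) (Real.log α) := by
    refine ⟨(abs_agmLog_sub_log_le hβ hα).trans ?_, by simpa using hα'⟩
    linarith
  -- The error constants after the six operations are 79, 136, 183, 232, 278 and 325.
  have s1 := (hL n le_rfl).fsub hr hM (hL k hk) (by linarith) (by linarith) (by linarith)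
  have s2 := s1.fsub hr hM (hL (n - k) (Nat.sub_le n k)) (by linarith) (by linarith) (by linarith)
  have s3 := s2.fadd hr hM a4 (by linarith) (by linarith) (by linarith)
  have s4 := s3.fadd hr hM a5 (by linarith) (by linarith) (by linarith)
  have s5 := s4.fadd hr hM a6 (by linarith) (by linarith) (by linarith)
  have s6 := s5.fsub hr hM a7 (by linarith) (by linarith) (by linarith)
  refine s6.err.trans ?_
  norm_num
  gcongr
  norm_num

end BinSamp
end

/-! ### The error of the rejection ratio -/

theorem mainTheorem5 (t : ℕ) (g : ℝ) (hg : 0 < g + 1 / 2)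
    (E : BinSamp.HatExpr) (K αmax : ℝ) :
    ∃ R : ℕ → ℝ, R =o[atTop] BinSamp.eps ∧
      ∀ᶠ β : ℕ in atTop,
        ∀ rnd : ℝ → ℝ, BinSamp.IsRounding β rnd →
        ∀ n : ℕ, 1 ≤ n → 2 * ⌈Real.logb 2 n⌉ ≤ (β : ℤ) →
        ∀ p : ℝ, 0 < p → p < 1 →
          ⌈-Real.logb 2 p⌉ ≤ (β : ℤ) → ⌈-Real.logb 2 (1 - p)⌉ ≤ (β : ℤ) →
        (∀ j ≤ n, 0 < BinSamp.lanczosA t g j) →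
        ∀ (α : ℝ) (h : ℕ → ℝ), α ≤ αmax → BinSamp.IsHat n p α h →
        ∀ k ≤ n, ∀ u ∈ Set.Icc (-(1 / 2) : ℝ) (1 / 2),
          E.eval n p u = 1 / h k → E.WellConditioned K n p u →
          |BinSamp.computedRatio rnd β t g n p α E u k
              / BinSamp.ratioInter t g n p α h k - 1|
            ≤ (1110 * (n : ℝ) + 2540) * (β : ℝ) * BinSamp.eps β
              + 14 * BinSamp.eps β * Real.log (h k) + R β := by
  open BinSamp in
  refine ⟨fun _ => 0, isLittleO_zero _ _, ?_⟩
  obtain ⟨C, hC, hE⟩ := E.exists_relErr_fleval K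
  have hβC : ∀ C : ℝ, ∀ᶠ β : ℕ in atTop, C ≤ β := fun C =>
    tendsto_natCast_atTop_atTop.eventually_ge_atTop C
  have small : ∀ (c : ℝ) (j : ℕ), ∀ᶠ β : ℕ in atTop, c * ((β : ℝ) ^ j * eps β) ≤ 1 / 2 :=
    fun c j => by
      have := (tendsto_pow_mul_eps j).const_mul c
      rw [mul_zero] at this
      exact this.eventually_le_const (by norm_num)
  filter_upwards [hE, eventually_approx_logFactorial t hg, eventually_ge_atTop 20,
    hβC (2 * C), hβC (Real.log αmax), small C 0, small 1000 0, small (331 ^ 2) 2]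
    with β hE hF hβ h2C hβα hs1 hs2 hs3 rnd hr n hn hnβ p hp hp1 hpβ hqβ hA α h hα hh k hk u _
      hEu hW
  simp only [pow_zero, one_mul] at hs1 hs2
  have e0 := eps_pos β
  have hn' : (1 : ℝ) ≤ n := by exact_mod_cast hn
  have hβ' : (20 : ℝ) ≤ β := by exact_mod_cast hβ
  have hβM : (β : ℝ) ≤ n * β := by nlinarith
  obtain ⟨hn2, hnl⟩ := sq_le_and_log_le_of_ceil_logb_le hn hnβ
  have hl := neg_log_le_of_ceil_logb_le hpβ
  have hl' := neg_log_le_of_ceil_logb_le hqβ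
  obtain ⟨hb, hbl⟩ := neg_log_binom_le hk hp hp1 hl hl'
  have hα0 := hh.rate_pos
  -- Domination of a positive binomial mass forces h(k) > 0; quantitatively it also gives log h(k) ≥
  -- −2nβ below.
  have hk0 : 0 < h k := by
    have := hb.trans_le (hh.dominates k hk)
    exact pos_of_mul_pos_right this hα0.le
  have hk1 := hh.le_one k hk
  have hlh : Real.log (h k) ≤ 0 := Real.log_nonpos hk0.le hk1
  have hdom := Real.log_le_log hb (hh.dominates k hk)
  rw [Real.log_mul hα0.ne' hk0.ne'] at hdom
  have hαβ : Real.log α ≤ β := (Real.log_le_log hα0 hα).trans hβα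
  have hαl : |Real.log α| ≤ n * β := by
    rw [abs_le]; constructor <;> linarith
  have hX : |Real.log (1 / h k)| ≤ 2 * (n * β) := by
    rw [one_div, Real.log_inv, abs_neg, abs_of_nonpos hlh]; linarith
  have hrel := hE rnd hr n p u hW
  rw [hEu] at hrel
  obtain ⟨hx, hxX⟩ := hrel.abs_log_sub_log_le hs1 (by positivity)
  have hΔ := approx_logRatio hr hβ (by linarith) hk hn (fun j hj => hF n hn hnl j hj (hA j hj))
    hp hp1 hl hl' hx (hxX.trans (by nlinarith)) hX hα0 hαl
  obtain ⟨hρ, hρl⟩ := log_ratioInter hg hp hp1 hk hA hα0 hk0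
  rw [← hρl] at hΔ
  -- The precision hypothesis only gives n ≤ 2^(β/2), so the square is split into β²ε, which tends
  -- to 0, and n²ε ≤ 1.
  have hM1 : 331 * (n * β * eps β) ≤ 1 := by
    rw [← sq_le_one_iff₀ (by positivity)]
    calc (331 * (n * β * eps β)) ^ 2
        = 331 ^ 2 * ((β : ℝ) ^ 2 * eps β) * ((n : ℝ) ^ 2 * eps β) := by ring
      _ ≤ 1 / 2 * 1 := by gcongr
      _ ≤ 1 := by norm_num
  have key : computedRatio rnd β t g n p α E u k / ratioInter t g n p α h k
      = Real.exp (logRatio rnd β t g n p α (E.fleval rnd n p u) k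
        - Real.log (ratioInter t g n p α h k)) := by
    rw [Real.exp_sub, Real.exp_log hρ, computedRatio]
  rw [key]
  refine (Real.abs_exp_sub_one_le (hΔ.trans hM1)).trans ?_
  have hlast : -(2 * (n * β)) * eps β ≤ Real.log (h k) * eps β := by
    gcongr
    linarith
  have : 0 ≤ n * β * eps β := by positivity
  have : 0 ≤ β * eps β := by positivity
  linarith
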